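/- Let $\mathbb{R}_+=(0,\infty)$. A weight is a positive function on $\mathbb{R}_+$ that is integrable on every compact subset of $\mathbb{R}_+$. For a weight $v$, $1<p<\infty$ and a measurable function $f$ on $\mathbb{R}_+$ (real- or complex-valued) put $$\|f\|_{L_p^v}=\Big(\int_0^\infty v(x)^p|f(x)|^p\,dx\Big)^{1/p}\in[0,\infty].$$ The Struve function of order $\alpha$ is $$\mathbf{H}_\alpha(x)=\Big(\frac{x}{2}\Big)^{\alpha+1}\sum_{k=0}^\infty\frac{(-1)^k(x/2)^{2k}}{\Gamma(k+\frac32)\,\Gamma(k+\alpha+\frac32)},\qquad x>0,$$ and the Struve transform of $f$ is $$\mathscr{H}_\alpha f(y)=\lim_{N\to\infty}\int_0^N (xy)^{1/2}\,\mathbf{H}_\alpha(xy)\,f(x)\,dx,\qquad y>0.$$ We say that $\mathscr{H}_\alpha f$ exists pointwise if, for every $y>0$, the function $x\mapsto (xy)^{1/2}\mathbf{H}_\alpha(xy)f(x)$ is integrable on $(0,N)$ for every $N>0$ and this limit exists and is finite. **Theorem.** Let $1<p\le q<\infty$, let $p'=p/(p-1)$, let $\alpha>\frac12$, and let $u$ and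 $v$ be weights. Then there is a constant $C>0$ such that $$\|\mathscr{H}_\alpha f\|_{L_q^u}\le C\,\|f\|_{L_p^v}$$ for every measurable $f$ on $\mathbb{R}_+$ for which $\mathscr{H}_\alpha f$ exists pointwise, if and only if $$\sup_{t>0}\bigg(\int_0^\infty\Big(\frac{x^{\alpha+\frac32}}{t^{-2}+x^2}\Big)^{q}u(x)^q\,dx\bigg)^{\frac1q}\bigg(\int_0^\infty\Big(\frac{x^{\alpha+\frac32}}{t^{2}+x^2}\Big)^{p'}v(x)^{-p'}\,dx\bigg)^{\frac1{p'}}<\infty,$$ where the integrals take values in $(0,\infty]$. -/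

import Mathlib

open MeasureTheory Filter Topology

noncomputable section

/-- The Struve function of order `α`, given for `x > 0` by its series
`H_α(x) = (x/2)^(α+1) ∑ₖ (-1)^k (x/2)^(2k) / (Γ(k+3/2) Γ(k+α+3/2))`. -/
def struveH (α x : ℝ) : ℝ :=
  (x / 2) ^ (α + 1) *
    ∑' k : ℕ, (-1 : ℝ) ^ k * (x / 2) ^ (2 * k) /
      (Real.Gamma ((k : ℝ) + 3 / 2) * Real.Gamma ((k : ℝ) + α + 3 / 2))

/-- The kernel `(xy)^(1/2) H_α(xy)` of the Struve transform. -/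
def struveKernel (α x y : ℝ) : ℝ :=
  (x * y) ^ (1 / 2 : ℝ) * struveH α (x * y)

/-- The truncated transform `∫_0^N f(x) (xy)^(1/2) H_α(xy) dx`. -/
def truncatedStruveTransform {𝕜 : Type*} [RCLike 𝕜] (α : ℝ) (f : ℝ → 𝕜) (y N : ℝ) : 𝕜 :=
  ∫ x in Set.Ioc 0 N, struveKernel α x y • f x

/-- The Struve transform `y ↦ ∫_0^∞ f(x) (xy)^(1/2) H_α(xy) dx`, an improper integral at infinity.
It is used only for `f` satisfying `HasStruveTransform α f`, for which the limit exists. -/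
def struveTransform {𝕜 : Type*} [RCLike 𝕜] (α : ℝ) (f : ℝ → 𝕜) (y : ℝ) : 𝕜 :=
  limUnder atTop (truncatedStruveTransform α f y)

/-- `f` is a (Lebesgue) measurable function on `(0, ∞)` whose Struve transform exists pointwise:
for every `y > 0` the integrals over `(0, N]` are Lebesgue integrals and converge to a finite limit
as `N → ∞`. -/
structure HasStruveTransform {𝕜 : Type*} [RCLike 𝕜] (α : ℝ) (f : ℝ → 𝕜) : Prop where
  measurable : AEStronglyMeasurable f (volume.restrict (Set.Ioi 0))
  integrable : ∀ y : ℝ, 0 < y → ∀ N : ℝ,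
    IntegrableOn (fun x => struveKernel α x y • f x) (Set.Ioc 0 N)
  converges : ∀ y : ℝ, 0 < y → ∃ l : 𝕜, Tendsto (truncatedStruveTransform α f y) atTop (𝓝 l)

/-- A weight: a positive locally integrable function on `(0, ∞)`
(values outside `(0, ∞)` are irrelevant). -/
structure IsWeight (u : ℝ → ℝ) : Prop where
  pos : ∀ x : ℝ, 0 < x → 0 < u x
  locallyIntegrable : LocallyIntegrableOn u (Set.Ioi 0)

/-- The weighted Lebesgue norm `(∫_0^∞ v(x)^p |f(x)|^p dx)^(1/p)`, with values in `[0, ∞]`. -/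
def weightedNorm {𝕜 : Type*} [RCLike 𝕜] (p : ℝ) (v : ℝ → ℝ) (f : ℝ → 𝕜) : ENNReal :=
  (∫⁻ x in Set.Ioi 0, ENNReal.ofReal (v x ^ p * ‖f x‖ ^ p)) ^ (1 / p)

end

open scoped ENNReal

/-! Put `a = α + 3/2`. For `α > 1/2` the kernel `s^(1/2) H_α(s)` is positive and comparable to `s^a
/ (1 + s²)`: a Poisson-type formula writes `H_α(s)` as a positive multiple of `s^(α-1) ∫ (1 -
w)^(α-3/2) (1 - cos (s √w)) dw` over `[0, 1]`, and this integral is comparable to `s² / (1 + s²)`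
(`exists_struve_bounds`). No oscillation is left, so the theorem concerns a positive operator of
Stieltjes type.

Sufficiency: with `s = xy`, the model kernel is at most `s^a` and at most `s^(a-2)`. Using the first
for `x < 1/y` and the second for `x > 1/y` leaves two Hardy operators with product kernels. A
two-weight Hardy inequality (`lintegral_measure_Iio_rpow_le`) bounds each by a Muckenhoupt
condition, and both conditions follow from the given supremum, since up to constants the weights in
it dominate the cut-off powers.

Necessity: for each `t` the model kernel dominates the product of the weights `y^a / (t⁻² + y²)` and
`x^a / (t² + x²)` (`stieltjesWeight_mul_le`). Testing the rank-one minorant on truncated extremals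
of Hölder's inequality gives the bound uniformly in `t`. -/

/-! ### Poisson-type integral for the Struve function -/

theorem intervalIntegrable_one_sub_rpow {β : ℝ} (hβ : 0 < β) :
    IntervalIntegrable (fun s : ℝ => (1 - s) ^ (β - 1)) volume 0 1 := by
  have h := (intervalIntegral.intervalIntegrable_rpow' (a := 0) (b := 1) (r := β - 1)
    (by linarith)).comp_sub_left 1
  simpa using h.symm

theorem integral_pow_mul_one_sub_rpow {β : ℝ} (hβ : 0 < β) (k : ℕ) :
    ∫ s in (0 : ℝ)..1, s ^ k * (1 - s) ^ (β - 1) =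
      (k.factorial : ℝ) * Real.Gamma β / Real.Gamma (k + 1 + β) := by
  have h := Complex.Gamma_mul_Gamma_eq_betaIntegral (s := ((k + 1 : ℝ) : ℂ)) (t := (β : ℂ))
    (by simp; positivity) (by simpa)
  have hb : Complex.betaIntegral ((k + 1 : ℝ) : ℂ) (β : ℂ) =
      ((∫ s in (0 : ℝ)..1, s ^ k * (1 - s) ^ (β - 1) : ℝ) : ℂ) := by
    rw [Complex.betaIntegral, ← intervalIntegral.integral_ofReal]
    refine intervalIntegral.integral_congr fun s hs => ?_
    rw [Set.uIcc_of_le zero_le_one] at hs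
    simp only [Complex.ofReal_mul, Complex.ofReal_pow]
    rw [Complex.ofReal_cpow (by linarith [hs.2])]
    push_cast
    rw [add_sub_cancel_right, Complex.cpow_natCast]
  rw [hb, ← Complex.ofReal_add, Complex.Gamma_ofReal, Complex.Gamma_ofReal, Complex.Gamma_ofReal,
    Real.Gamma_nat_eq_factorial] at h
  have hG : Real.Gamma (k + 1 + β) ≠ 0 := (Real.Gamma_pos_of_pos (by positivity)).ne'
  rw [eq_div_iff hG, mul_comm]
  exact_mod_cast h.symm

/-- Legendre's duplication formula at `j + 3/2`; it converts the factorials of the cosine series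
into the Gamma factors of the Struve series. -/
theorem factorial_two_mul_add_two (j : ℕ) :
    (((2 * j + 2).factorial : ℕ) : ℝ) * √Real.pi =
      2 ^ (2 * j + 2) * ((j + 1).factorial : ℝ) * Real.Gamma (j + 3 / 2) := by
  have h := Real.Gamma_mul_Gamma_add_half ((j : ℝ) + 3 / 2)
  have e1 : (j : ℝ) + 3 / 2 + 1 / 2 = ((j + 1 : ℕ) : ℝ) + 1 := by push_cast; ring
  have e2 : 2 * ((j : ℝ) + 3 / 2) = ((2 * j + 2 : ℕ) : ℝ) + 1 := by push_cast; ring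
  have e3 : 1 - 2 * ((j : ℝ) + 3 / 2) = -((2 * j + 2 : ℕ) : ℝ) := by push_cast; ring
  rw [e3, e1, e2, Real.Gamma_nat_eq_factorial, Real.Gamma_nat_eq_factorial,
    Real.rpow_neg zero_le_two, Real.rpow_natCast] at h
  rw [← div_eq_mul_inv, div_mul_eq_mul_div, eq_div_iff (by positivity)] at h
  linarith

theorem hasSum_one_sub_cos (x : ℝ) {s : ℝ} (hs : 0 ≤ s) :
    HasSum (fun j : ℕ => (-1 : ℝ) ^ j * (x ^ (2 * j + 2) * s ^ (j + 1)) /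
      ((2 * j + 2 : ℕ).factorial : ℝ)) (1 - Real.cos (x * √s)) := by
  have h := (hasSum_nat_add_iff' 1).2 (Real.hasSum_cos (x * √s))
  have h' := h.neg
  simp only [Finset.range_one, Finset.sum_singleton] at h'
  convert h' using 1
  · rfl
  · funext j
    have : (x * √s) ^ (2 * (j + 1)) = x ^ (2 * j + 2) * s ^ (j + 1) := by
      rw [mul_pow, pow_mul (√s), Real.sq_sqrt hs]; ring
    rw [this, show 2 * (j + 1) = 2 * j + 2 by ring]
    ring
  · norm_num

/-- The normalised Struve function `∫ β (1 - s)^(β - 1) (1 - cos (x √s)) ds` on `[0, 1]`. -/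
noncomputable def struveCosIntegral (β x : ℝ) : ℝ :=
  ∫ s in (0 : ℝ)..1, (1 - s) ^ (β - 1) * (1 - Real.cos (x * √s))

/-- Expand `1 - cos (x √s)` in powers of `s` and integrate term by term: each term is a beta
integral. The condition `α > 1/2` makes the weight `(1 - s)^(α - 3/2)` integrable, and the cosine
series is dominated by an exponential series uniformly in `s`. -/
theorem hasSum_struve_series {α : ℝ} (hα : 1 / 2 < α) (x : ℝ) :
    HasSum (fun k : ℕ => (x / 2) ^ 2 * (√Real.pi * Real.Gamma (α - 1 / 2)) *
      ((-1 : ℝ) ^ k * (x / 2) ^ (2 * k) /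
        (Real.Gamma ((k : ℝ) + 3 / 2) * Real.Gamma ((k : ℝ) + α + 3 / 2))))
      (struveCosIntegral (α - 1 / 2) x) := by
  have hβ : 0 < α - 1 / 2 := by linarith
  have hw := intervalIntegrable_one_sub_rpow hβ
  have hsum : Summable fun j : ℕ => |x| ^ (2 * j + 2) / ((2 * j + 2 : ℕ).factorial : ℝ) :=
    (Real.summable_pow_div_factorial |x|).comp_injective
      (i := fun j : ℕ => 2 * j + 2) (fun a b h => by simpa using h)
  have key := intervalIntegral.hasSum_integral_of_dominated_convergence (μ := volume) (a := 0)
    (b := 1)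
    (F := fun (j : ℕ) (s : ℝ) => (1 - s) ^ (α - 1 / 2 - 1) * ((-1 : ℝ) ^ j *
      (x ^ (2 * j + 2) * s ^ (j + 1)) / ((2 * j + 2 : ℕ).factorial : ℝ)))
    (f := fun s => (1 - s) ^ (α - 1 / 2 - 1) * (1 - Real.cos (x * √s)))
    (fun j s => (1 - s) ^ (α - 1 / 2 - 1) * (|x| ^ (2 * j + 2) / ((2 * j + 2 : ℕ).factorial : ℝ)))
    (fun j => ?_) (fun j => ?_) ?_ ?_ ?_
  · convert key using 1
    · rfl
    swap
    · rfl
    funext k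
    have e : ∀ s : ℝ, (1 - s) ^ (α - 1 / 2 - 1) * ((-1 : ℝ) ^ k *
        (x ^ (2 * k + 2) * s ^ (k + 1)) / ((2 * k + 2 : ℕ).factorial : ℝ)) =
        ((-1 : ℝ) ^ k * x ^ (2 * k + 2) / ((2 * k + 2 : ℕ).factorial : ℝ)) *
          (s ^ (k + 1) * (1 - s) ^ (α - 1 / 2 - 1)) := fun s => by ring
    simp_rw [e]
    rw [intervalIntegral.integral_const_mul, integral_pow_mul_one_sub_rpow hβ]
    have e2 : ((k + 1 : ℕ) : ℝ) + 1 + (α - 1 / 2) = k + α + 3 / 2 := by push_cast; ring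
    rw [e2]
    have h1 := factorial_two_mul_add_two k
    have g1 : Real.Gamma ((k : ℝ) + 3 / 2) ≠ 0 := (Real.Gamma_pos_of_pos (by positivity)).ne'
    have g2 : Real.Gamma ((k : ℝ) + α + 3 / 2) ≠ 0 :=
      (Real.Gamma_pos_of_pos (by positivity)).ne'
    have f1 : ((2 * k + 2 : ℕ).factorial : ℝ) ≠ 0 := by positivity
    have e3 : x ^ (2 * k + 2) = (x / 2) ^ 2 * (x / 2) ^ (2 * k) * 2 ^ (2 * k + 2) := by
      rw [← pow_add, add_comm 2, ← mul_pow, div_mul_cancel₀ _ two_ne_zero]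
    rw [e3]
    generalize Real.Gamma ((k : ℝ) + 3 / 2) = G₁ at *
    generalize Real.Gamma ((k : ℝ) + α + 3 / 2) = G₂ at *
    generalize Real.Gamma (α - 1 / 2) = G₃ at *
    field_simp
    linear_combination (G₃ * x ^ 2 * (x / 2) ^ (2 * k)) * h1
  · exact (by fun_prop : Measurable _).aestronglyMeasurable
  · refine ae_of_all _ fun s hs => ?_
    rw [Set.uIoc_of_le zero_le_one] at hs
    have : (0 : ℝ) ≤ (1 - s) ^ (α - 1 / 2 - 1) := Real.rpow_nonneg (by linarith [hs.2]) _
    rw [norm_mul, Real.norm_of_nonneg this, Real.norm_eq_abs, abs_div, abs_mul, abs_mul, abs_pow,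
      abs_pow, abs_pow, abs_neg, abs_one, one_pow, one_mul, Nat.abs_cast, abs_of_nonneg hs.1.le]
    gcongr
    exact mul_le_of_le_one_right (by positivity) (pow_le_one₀ hs.1.le hs.2)
  · exact ae_of_all _ fun s _ => hsum.mul_left _
  · simp_rw [tsum_mul_left]
    exact hw.mul_const _
  · refine ae_of_all _ fun s hs => ?_
    rw [Set.uIoc_of_le zero_le_one] at hs
    exact (hasSum_one_sub_cos x hs.1.le).mul_left _

theorem struveH_eq {α : ℝ} (hα : 1 / 2 < α) {x : ℝ} (hx : 0 < x) :
    struveH α x = (x / 2) ^ (α + 1) * (struveCosIntegral (α - 1 / 2) x /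
      ((x / 2) ^ 2 * (√Real.pi * Real.Gamma (α - 1 / 2)))) := by
  have h := (hasSum_struve_series hα x).tsum_eq
  have : 0 < Real.Gamma (α - 1 / 2) := Real.Gamma_pos_of_pos (by linarith)
  have hpi := Real.pi_pos
  rw [tsum_mul_left] at h
  rw [struveH, ← h, mul_div_cancel_left₀ _ (by positivity)]

/-! ### Two-sided bounds for the kernel -/

theorem intervalIntegrable_struveCosIntegrand {β : ℝ} (hβ : 0 < β) (x : ℝ) :
    IntervalIntegrable (fun s => (1 - s) ^ (β - 1) * (1 - Real.cos (x * √s))) volume 0 1 :=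
  (intervalIntegrable_one_sub_rpow hβ).mul_continuousOn (by fun_prop)

theorem struveCosIntegral_le {β : ℝ} (hβ : 0 < β) (x : ℝ) :
    struveCosIntegral β x ≤ 5 / (2 * β) * (x ^ 2 / (1 + x ^ 2)) := by
  have hI : ∫ s in (0 : ℝ)..1, (1 - s) ^ (β - 1) = 1 / β := by
    have := integral_pow_mul_one_sub_rpow hβ 0
    simp only [pow_zero, one_mul, Nat.factorial_zero, Nat.cast_one, Nat.cast_zero, zero_add] at this
    rw [this, add_comm, Real.Gamma_add_one hβ.ne']
    have := (Real.Gamma_pos_of_pos hβ).ne'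
    field_simp
  -- `1 - cos (x √s) ≤ min 2 (x² / 2)`, and `5/2` is the least constant making this minimum at most
  -- a multiple of `x² / (1 + x²)`; equality occurs at `x² = 4`.
  have h : ∀ s ∈ Set.Icc (0 : ℝ) 1, (1 - s) ^ (β - 1) * (1 - Real.cos (x * √s)) ≤
      (1 - s) ^ (β - 1) * (5 / 2 * (x ^ 2 / (1 + x ^ 2))) := by
    intro s hs
    refine mul_le_mul_of_nonneg_left ?_ (Real.rpow_nonneg (by linarith [hs.2]) _)
    have h1 := Real.neg_one_le_cos (x * √s)
    have h2 := Real.one_sub_sq_div_two_le_cos (x := x * √s)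
    rw [mul_pow, Real.sq_sqrt hs.1] at h2
    have h3 : x ^ 2 * s ≤ x ^ 2 := mul_le_of_le_one_right (by positivity) hs.2
    rw [← mul_div_assoc, le_div_iff₀ (by positivity)]
    rcases le_total (x ^ 2) 4 with h4 | h4 <;> nlinarith [sq_nonneg x]
  calc struveCosIntegral β x
      ≤ ∫ s in (0 : ℝ)..1, (1 - s) ^ (β - 1) * (5 / 2 * (x ^ 2 / (1 + x ^ 2))) :=
        intervalIntegral.integral_mono_on zero_le_one (intervalIntegrable_struveCosIntegrand hβ x)
          ((intervalIntegrable_one_sub_rpow hβ).mul_const _) h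
    _ = _ := by
      rw [intervalIntegral.integral_mul_const, hI]
      field_simp

/-- The integrand is nonnegative, so the range may be cut to a part where `1 - s ≥ 7/16`. Passing
through `(1 - s)^β ≤ (1 - s)^(β - 1)` avoids distinguishing the sign of `β - 1`. -/
theorem integral_le_struveCosIntegral {β : ℝ} (hβ : 0 < β) (x : ℝ) {b : ℝ} (hb : 1 / 16 ≤ b)
    (hb' : b ≤ 9 / 16) :
    (7 / 16 : ℝ) ^ β * ∫ s in (1 / 16 : ℝ)..b, (1 - Real.cos (x * √s)) ≤
      struveCosIntegral β x := by
  have hi := intervalIntegrable_struveCosIntegrand hβ x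
  have hnn : ∀ s ∈ Set.Icc (0 : ℝ) 1, 0 ≤ (1 - s) ^ (β - 1) * (1 - Real.cos (x * √s)) :=
    fun s hs => mul_nonneg (Real.rpow_nonneg (by linarith [hs.2]) _)
      (by linarith [Real.cos_le_one (x * √s)])
  have hsub : Set.uIcc (1 / 16 : ℝ) b ⊆ Set.uIcc 0 1 := by
    rw [Set.uIcc_of_le hb, Set.uIcc_of_le zero_le_one]
    exact Set.Icc_subset_Icc (by norm_num) (by linarith)
  calc (7 / 16 : ℝ) ^ β * ∫ s in (1 / 16 : ℝ)..b, (1 - Real.cos (x * √s))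
      = ∫ s in (1 / 16 : ℝ)..b, (7 / 16 : ℝ) ^ β * (1 - Real.cos (x * √s)) := by
        rw [intervalIntegral.integral_const_mul]
    _ ≤ ∫ s in (1 / 16 : ℝ)..b, (1 - s) ^ (β - 1) * (1 - Real.cos (x * √s)) := by
        refine intervalIntegral.integral_mono_on hb
          (Continuous.intervalIntegrable (by fun_prop) _ _) (hi.mono_set hsub) fun s hs => ?_
        refine mul_le_mul_of_nonneg_right ?_ (by linarith [Real.cos_le_one (x * √s)])
        have h1 : 7 / 16 ≤ 1 - s := by linarith [hs.2]
        calc (7 / 16 : ℝ) ^ β ≤ (1 - s) ^ β := by gcongr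
          _ ≤ (1 - s) ^ (β - 1) :=
            Real.rpow_le_rpow_of_exponent_ge (by linarith) (by linarith [hs.1]) (by linarith)
    _ ≤ struveCosIntegral β x := by
        refine intervalIntegral.integral_mono_interval (by norm_num) hb (by linarith) ?_ hi
        refine (ae_restrict_iff' measurableSet_Ioc).2 (ae_of_all _ fun s hs => ?_)
        exact hnn s ⟨hs.1.le, hs.2⟩

theorem integral_one_sub_cos_mul_sqrt {x : ℝ} (hx : 0 < x) :
    ∫ s in (1 / 16 : ℝ)..(9 / 16), (1 - Real.cos (x * √s)) =
      1 / 2 - 3 / 2 * Real.sin (x * (3 / 4)) / x - 2 * Real.cos (x * (3 / 4)) / x ^ 2 +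
        1 / 2 * Real.sin (x * (1 / 4)) / x + 2 * Real.cos (x * (1 / 4)) / x ^ 2 := by
  have hd : ∀ s ∈ Set.uIcc (1 / 16 : ℝ) (9 / 16), HasDerivAt
      (fun s => s - 2 * √s * Real.sin (x * √s) / x - 2 * Real.cos (x * √s) / x ^ 2)
      (1 - Real.cos (x * √s)) s := by
    intro s hs
    rw [Set.uIcc_of_le (by norm_num)] at hs
    have hs0 : 0 < s := by linarith [hs.1]
    have h1 := Real.hasDerivAt_sqrt hs0.ne'
    have h2 := h1.const_mul x
    have h3 := (((hasDerivAt_id' s).sub (((h1.const_mul 2).mul h2.sin).div_const x))).sub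
      ((h2.cos.const_mul 2).div_const (x ^ 2))
    refine h3.congr_deriv ?_
    have : √s ≠ 0 := by positivity
    field_simp
    ring
  rw [intervalIntegral.integral_eq_sub_of_hasDerivAt hd
    (Continuous.intervalIntegrable (by fun_prop) _ _)]
  have e1 : √(9 / 16 : ℝ) = 3 / 4 := by
    rw [show (9 / 16 : ℝ) = (3 / 4) ^ 2 by norm_num, Real.sqrt_sq (by norm_num)]
  have e2 : √(1 / 16 : ℝ) = 1 / 4 := by
    rw [show (1 / 16 : ℝ) = (1 / 4) ^ 2 by norm_num, Real.sqrt_sq (by norm_num)]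
  rw [e1, e2]
  ring

theorem le_struveCosIntegral {β : ℝ} (hβ : 0 < β) {x : ℝ} (hx : 0 < x) :
    (7 / 16 : ℝ) ^ β * (1 / 2048) * (x ^ 2 / (1 + x ^ 2)) ≤ struveCosIntegral β x := by
  rw [mul_assoc]
  have hr : x ^ 2 / (1 + x ^ 2) ≤ 1 := by rw [div_le_one (by positivity)]; linarith
  rcases le_total 8 x with h8 | h8
  -- For `x ≥ 8` the explicit integral is its main term `1/2` minus errors of total size at most
  -- `5/16`.
  · refine le_trans ?_ (integral_le_struveCosIntegral hβ x (b := 9 / 16) (by norm_num) le_rfl)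
    gcongr
    rw [integral_one_sub_cos_mul_sqrt hx]
    have hx1 : x⁻¹ ≤ 1 / 8 := by rw [one_div]; gcongr
    have hx0 : 0 < x⁻¹ := by positivity
    have b1 : Real.sin (x * (3 / 4)) / x ≤ 1 / 8 := by
      rw [div_eq_mul_inv]; nlinarith [Real.sin_le_one (x * (3 / 4))]
    have b2 : -(1 / 8) ≤ Real.sin (x * (1 / 4)) / x := by
      rw [le_div_iff₀ hx]; linarith [Real.neg_one_le_sin (x * (1 / 4))]
    have hx2 : (x ^ 2)⁻¹ ≤ 1 / 64 := by
      rw [← inv_pow]; nlinarith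
    have hx20 : 0 < (x ^ 2)⁻¹ := by positivity
    have b3 : Real.cos (x * (3 / 4)) / x ^ 2 ≤ 1 / 64 := by
      rw [div_eq_mul_inv]; nlinarith [Real.cos_le_one (x * (3 / 4))]
    have b4 : -(1 / 64) ≤ Real.cos (x * (1 / 4)) / x ^ 2 := by
      rw [le_div_iff₀ (by positivity)]; nlinarith [Real.neg_one_le_cos (x * (1 / 4))]
    simp only [mul_div_assoc]
    linarith
  -- For `x ≤ 8` the cut `s ≤ 9/64` keeps `x √s ≤ 3 < π`, where `1 - cos θ ≥ 2 θ² / π² ≥ θ² / 8`.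
  -- With `s ≥ 1/16` the integrand is at least `x² / 128` on a length `5/64`, which exceeds `x² /
  -- 2048`.
  · refine le_trans ?_ (integral_le_struveCosIntegral hβ x (b := 9 / 64) (by norm_num)
      (by norm_num))
    gcongr
    have hpi := Real.pi_gt_three
    have hpi4 := Real.pi_le_four
    have hlow : ∀ s ∈ Set.Icc (1 / 16 : ℝ) (9 / 64), x ^ 2 * (1 / 128) ≤
        1 - Real.cos (x * √s) := by
      intro s hs
      have hs0 : 0 ≤ s := by linarith [hs.1]
      have hsq : √s ≤ 3 / 8 := by
        rw [Real.sqrt_le_left (by norm_num)]; linarith [hs.2]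
      have h0 : |x * √s| ≤ Real.pi := by
        rw [abs_of_nonneg (by positivity)]
        nlinarith [Real.sqrt_nonneg s]
      have h1 := Real.cos_le_one_sub_mul_cos_sq h0
      rw [mul_pow, Real.sq_sqrt hs0] at h1
      have h2 : (1 / 8 : ℝ) ≤ 2 / Real.pi ^ 2 := by
        rw [le_div_iff₀ (by positivity)]; nlinarith
      have h3 : (1 / 8 : ℝ) * (x ^ 2 * (1 / 16)) ≤ 2 / Real.pi ^ 2 * (x ^ 2 * s) := by
        have := hs.1
        gcongr
      linarith
    have := intervalIntegral.integral_mono_on (a := (1 / 16 : ℝ)) (b := 9 / 64) (μ := volume)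
      (by norm_num) (intervalIntegrable_const (c := x ^ 2 * (1 / 128)))
      (Continuous.intervalIntegrable (by fun_prop) _ _) hlow
    refine le_trans ?_ this
    rw [intervalIntegral.integral_const, smul_eq_mul]
    have hr2 : x ^ 2 / (1 + x ^ 2) ≤ x ^ 2 := div_le_self (by positivity) (by nlinarith)
    linarith [sq_nonneg x]

/-- For `α > 1/2` the function `s^(1/2) H_α(s)` is comparable to `s^(α+3/2) / (1 + s²)`. -/
theorem exists_struve_bounds {α : ℝ} (hα : 1 / 2 < α) : ∃ c C : ℝ, 0 < c ∧ 0 < C ∧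
    ∀ s : ℝ, 0 < s → c * (s ^ (α + 3 / 2) / (1 + s ^ 2)) ≤ s ^ (1 / 2 : ℝ) * struveH α s ∧
      s ^ (1 / 2 : ℝ) * struveH α s ≤ C * (s ^ (α + 3 / 2) / (1 + s ^ 2)) := by
  have hβ : 0 < α - 1 / 2 := by linarith
  have hG : 0 < Real.Gamma (α - 1 / 2) := Real.Gamma_pos_of_pos hβ
  have hpi := Real.pi_pos
  set D : ℝ := (1 / 2) ^ (α + 1) * (4 / (√Real.pi * Real.Gamma (α - 1 / 2))) with hD
  have hD0 : 0 < D := by positivity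
  refine ⟨D * ((7 / 16 : ℝ) ^ (α - 1 / 2) * (1 / 2048)), D * (5 / (2 * (α - 1 / 2))),
    by positivity, by positivity, fun s hs => ?_⟩
  have e : s ^ (1 / 2 : ℝ) * struveH α s =
      D * (s ^ (α + 3 / 2) / s ^ 2) * struveCosIntegral (α - 1 / 2) s := by
    rw [struveH_eq hα hs, hD, show α + 3 / 2 = 1 / 2 + (α + 1) by ring, Real.rpow_add hs,
      div_eq_mul_one_div s 2, Real.mul_rpow hs.le (by norm_num)]
    field_simp
    ring
  have e' : ∀ K : ℝ, D * K * (s ^ (α + 3 / 2) / (1 + s ^ 2)) =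
      D * (s ^ (α + 3 / 2) / s ^ 2) * (K * (s ^ 2 / (1 + s ^ 2))) := fun K => by
    field_simp
  rw [e, e', e']
  have hp : 0 ≤ D * (s ^ (α + 3 / 2) / s ^ 2) := by positivity
  exact ⟨mul_le_mul_of_nonneg_left (le_struveCosIntegral hβ hs) hp,
    mul_le_mul_of_nonneg_left (struveCosIntegral_le hβ s) hp⟩

theorem measurable_struveH (α : ℝ) : Measurable (struveH α) := by
  unfold struveH
  refine Measurable.mul (by fun_prop) (Measurable.tsum fun k => by fun_prop)

/-! ### Two-weight Hardy inequality -/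

/-- A countable set of points coinitial in `S` exhausts `S` by a directed union of the sets `S ∩ Ici
t`. Atoms and infinite measures are allowed, and `S` need not have a least element. -/
theorem measure_le_of_forall_inter_Ici_le {ν : Measure ℝ} {S : Set ℝ} {c : ℝ≥0∞}
    (h : ∀ s ∈ S, ν (S ∩ Set.Ici s) ≤ c) : ν S ≤ c := by
  obtain ⟨T, hTS, hTc, hT⟩ : ∃ T ⊆ S, T.Countable ∧ ∀ x ∈ S, ∃ t ∈ T, t ≤ x := by
    by_cases hmin : ∃ m ∈ S, ∀ x ∈ S, m ≤ x
    · obtain ⟨m, hm, hle⟩ := hmin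
      exact ⟨{m}, by simpa using hm, Set.countable_singleton m, fun x hx => ⟨m, rfl, hle x hx⟩⟩
    · push Not at hmin
      choose t htS htr using fun r : {r : ℚ // ∃ t ∈ S, t < r} => r.2
      refine ⟨Set.range t, Set.range_subset_iff.2 htS, Set.countable_range t, fun x hx => ?_⟩
      obtain ⟨y, hy, hyx⟩ := hmin x hx
      obtain ⟨r, hyr, hrx⟩ := exists_rat_btwn hyx
      exact ⟨_, ⟨⟨r, y, hy, hyr⟩, rfl⟩, ((htr _).trans hrx).le⟩
  have hU : S ⊆ ⋃ t ∈ T, S ∩ Set.Ici t := fun x hx => by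
    obtain ⟨t, ht, hle⟩ := hT x hx
    exact Set.mem_biUnion ht ⟨hx, hle⟩
  refine (measure_mono hU).trans ?_
  rw [measure_biUnion_eq_iSup hTc]
  · exact iSup₂_le fun t ht => h t (hTS ht)
  · intro a ha b hb
    rcases le_total a b with hab | hab
    · exact ⟨a, ha, subset_rfl, Set.inter_subset_inter_right _ (Set.Ici_subset_Ici.2 hab)⟩
    · exact ⟨b, hb, Set.inter_subset_inter_right _ (Set.Ici_subset_Ici.2 hab), subset_rfl⟩

theorem measure_le_of_forall_inter_Iic_le {ν : Measure ℝ} {S : Set ℝ} {c : ℝ≥0∞}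
    (h : ∀ s ∈ S, ν (S ∩ Set.Iic s) ≤ c) : ν S ≤ c := by
  have key := measure_le_of_forall_inter_Ici_le (ν := ν.map (MeasurableEquiv.neg ℝ))
    (S := Neg.neg ⁻¹' S) (c := c) fun s hs => by
      rw [MeasurableEquiv.map_apply]
      refine le_trans (measure_mono ?_) (h (-s) hs)
      rintro x ⟨hx, hxs⟩
      change - -x ∈ S at hx
      change s ≤ -x at hxs
      exact ⟨by rwa [neg_neg] at hx, by simp only [Set.mem_Iic]; linarith⟩
  rw [MeasurableEquiv.map_apply] at key
  refine le_trans (measure_mono fun x hx => ?_) key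
  change - -x ∈ S
  rwa [neg_neg]

theorem ENNReal.tsum_rpow_le_rpow_tsum {ι : Type*} (a : ι → ℝ≥0∞) {r : ℝ} (hr : 1 ≤ r) :
    ∑' i, a i ^ r ≤ (∑' i, a i) ^ r := by
  have e : ∀ x : ℝ≥0∞, x ^ r = x * x ^ (r - 1) := fun x => by
    conv_lhs => rw [show r = 1 + (r - 1) by ring,
      ENNReal.rpow_add_of_nonneg _ _ zero_le_one (by linarith), ENNReal.rpow_one]
  simp_rw [e]
  rw [← ENNReal.tsum_mul_right]
  refine ENNReal.tsum_le_tsum fun i => ?_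
  gcongr
  exact ENNReal.le_tsum i

/-- A two-weight Hardy inequality for measures on the line. -/
theorem lintegral_measure_Iio_rpow_le {p p' q : ℝ} (hp : p.HolderConjugate p') (hpq : p ≤ q)
    {m₁ m₂ m₃ ν : Measure ℝ} {B : ℝ≥0∞} (hB : B ≠ ⊤) (hm₂ : m₂ Set.univ ≠ ⊤)
    (hm : ∀ E, MeasurableSet E → m₁ E ≤ m₂ E ^ (1 / p) * m₃ E ^ (1 / p'))
    (hν : ∀ s, ν (Set.Ici s) ^ (1 / q) * m₃ (Set.Iio s) ^ (1 / p') ≤ B) :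
    ∫⁻ s, m₁ (Set.Iio s) ^ q ∂ν ≤ (4 * B) ^ q * (2 * m₂ Set.univ) ^ (q / p) := by
  have hp0 := hp.pos
  have hp'0 := hp.symm.pos
  have hq0 : 0 < q := hp0.trans_le hpq
  set G : ℝ → ℝ≥0∞ := fun s => m₁ (Set.Iio s) with hG
  -- Two distribution functions are needed because `m₁` may have atoms: `H x ≤ G s` whenever `x <
  -- s`, while sublevel sets of `H` satisfy `m₁ {H ≤ c} ≤ c`.
  set H : ℝ → ℝ≥0∞ := fun s => m₁ (Set.Iic s) with hH
  have hGm : Monotone G := fun a b hab => measure_mono (Set.Iio_subset_Iio hab)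
  have hHm : Monotone H := fun a b hab => measure_mono (Set.Iic_subset_Iic.2 hab)
  have two0 : (2 : ℝ≥0∞) ≠ 0 := two_ne_zero
  have twot : (2 : ℝ≥0∞) ≠ ⊤ := by simp
  let e : ℤ → ℝ≥0∞ := fun k => 2 ^ k
  have he0 : ∀ k, e k ≠ 0 := fun k => (ENNReal.zpow_pos two0 twot k).ne'
  have het : ∀ k, e k ≠ ⊤ := fun k => (ENNReal.zpow_lt_top two0 twot k).ne
  have hes : ∀ k, e (k + 1) = 2 * e k := fun k => by
    simp only [e]
    rw [ENNReal.zpow_add two0 twot, zpow_one, mul_comm]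
  have hes' : ∀ k, e k = 2 * e (k - 1) := fun k => by rw [← hes, sub_add_cancel]
  have hem : Monotone e := fun a b hab => ENNReal.zpow_le_of_le (by norm_num) hab
  let S : ℤ → Set ℝ := fun k => G ⁻¹' Set.Ioc (e k) (e (k + 1))
  let E : ℤ → Set ℝ := fun k => H ⁻¹' Set.Ioc (e k) (e (k + 1))
  let D : ℤ → Set ℝ := fun k => H ⁻¹' Set.Ioc (e (k - 1)) (e (k + 1))
  have hSm : ∀ k, MeasurableSet (S k) := fun k => hGm.measurable measurableSet_Ioc
  have hEm : ∀ k, MeasurableSet (E k) := fun k => hHm.measurable measurableSet_Ioc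
  have hDm : ∀ k, MeasurableSet (D k) := fun k => hHm.measurable measurableSet_Ioc
  -- If `G s = ⊤`, Hölder and the finiteness of `m₂` force `m₃ (Iio s) = ⊤`, and then `B < ⊤` forces
  -- `ν (Ici s) = 0`.
  have htop : ν {s | G s = ⊤} = 0 := by
    refine le_antisymm (measure_le_of_forall_inter_Ici_le fun s hs => ?_) zero_le
    refine (measure_mono Set.inter_subset_right).trans ?_
    have h1 : m₃ (Set.Iio s) ^ (1 / p') = ⊤ := by
      have h2 := hm _ (measurableSet_Iio (a := s))
      rw [show m₁ (Set.Iio s) = ⊤ from hs, top_le_iff] at h2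
      by_contra h3
      refine ENNReal.mul_ne_top (ENNReal.rpow_ne_top_of_nonneg (by positivity) ?_) h3 h2
      exact ((measure_mono (Set.subset_univ _)).trans_lt hm₂.lt_top).ne
    have h2 := hν s
    rw [h1] at h2
    by_contra h3
    have h4 : ν (Set.Ici s) ≠ 0 := fun h => h3 h.le
    rw [ENNReal.mul_top (by simp [ENNReal.rpow_eq_zero_iff, h4, hq0.le])] at h2
    exact hB (top_le_iff.1 h2)
  have hpt : ∀ᵐ s ∂ν, G s ^ q ≤ ∑' k, (S k).indicator (fun _ => e (k + 1) ^ q) s := by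
    have hne : ∀ᵐ s ∂ν, G s ≠ ⊤ := by rw [ae_iff]; simpa using htop
    filter_upwards [hne] with s hs
    rcases eq_or_ne (G s) 0 with h0 | h0
    · rw [h0, ENNReal.zero_rpow_of_pos hq0]; exact zero_le
    obtain ⟨k, hk⟩ := ENNReal.exists_mem_Ioc_zpow h0 hs (by norm_num : (1 : ℝ≥0∞) < 2) twot
    refine le_trans ?_ (ENNReal.le_tsum k)
    rw [Set.indicator_of_mem (show s ∈ S k from hk)]
    exact ENNReal.rpow_le_rpow hk.2 hq0.le
  have hterm : ∀ k, e (k + 1) ^ q * ν (S k) ≤ (4 * B) ^ q * m₂ (D k) ^ (q / p) := by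
    intro k
    have ha0 : e (k + 1) ^ q ≠ 0 := by simp [ENNReal.rpow_eq_zero_iff, he0, het]
    have hat : e (k + 1) ^ q ≠ ⊤ := ENNReal.rpow_ne_top_of_nonneg hq0.le (het _)
    rw [mul_comm, ← ENNReal.le_div_iff_mul_le (Or.inl ha0) (Or.inl hat)]
    refine measure_le_of_forall_inter_Ici_le fun s hs => ?_
    rw [ENNReal.le_div_iff_mul_le (Or.inl ha0) (Or.inl hat)]
    -- For `s ∈ S k` the mass `G s` exceeds `e k = 2 e (k - 1)`, and the points with `H ≤ e (k - 1)`
    -- carry at most half of `e k`. So at least `e (k - 1)` lies in `D k ∩ Iio s`, where Hölder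
    -- localises `m₂` to `D k`.
    have h1 : m₁ {x | H x ≤ e (k - 1)} ≤ e (k - 1) :=
      measure_le_of_forall_inter_Iic_le fun x hx => (measure_mono Set.inter_subset_right).trans hx
    have h2 : m₁ (Set.Iio s) ≤ e (k - 1) + m₁ (D k ∩ Set.Iio s) := by
      refine le_trans (measure_mono fun x hx => ?_) ((measure_union_le _ _).trans (by gcongr))
      rcases le_or_gt (H x) (e (k - 1)) with h | h
      · exact Or.inl h
      · exact Or.inr ⟨⟨h, (measure_mono (Set.Iic_subset_Iio.2 hx)).trans hs.2⟩, hx⟩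
    have h3 : e (k - 1) ≤ m₁ (D k ∩ Set.Iio s) := by
      have h4 : e (k - 1) + e (k - 1) ≤ e (k - 1) + m₁ (D k ∩ Set.Iio s) := by
        rw [← two_mul, ← hes']
        exact hs.1.le.trans h2
      exact (ENNReal.add_le_add_iff_left (het _)).1 h4
    have h5 : e (k - 1) ≤ m₂ (D k) ^ (1 / p) * m₃ (Set.Iio s) ^ (1 / p') := by
      refine h3.trans ((hm _ ((hDm k).inter measurableSet_Iio)).trans ?_)
      gcongr
      · exact Set.inter_subset_left
      · exact Set.inter_subset_right
    calc ν (S k ∩ Set.Ici s) * e (k + 1) ^ q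
        ≤ ν (Set.Ici s) * (4 * e (k - 1)) ^ q := by
          have h6 : e (k + 1) = 4 * e (k - 1) := by
            rw [hes, hes' k, ← mul_assoc]; norm_num
          rw [h6]
          gcongr
          exact Set.inter_subset_right
      _ = (4 * (ν (Set.Ici s) ^ (1 / q) * e (k - 1))) ^ q := by
          rw [ENNReal.mul_rpow_of_nonneg _ _ hq0.le, ENNReal.mul_rpow_of_nonneg _ _ hq0.le,
            ENNReal.mul_rpow_of_nonneg _ _ hq0.le, ← ENNReal.rpow_mul, one_div_mul_cancel hq0.ne',
            ENNReal.rpow_one]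
          ring
      _ ≤ (4 * (ν (Set.Ici s) ^ (1 / q) * (m₂ (D k) ^ (1 / p) * m₃ (Set.Iio s) ^ (1 / p')))) ^ q := by
          gcongr
      _ = (4 * (ν (Set.Ici s) ^ (1 / q) * m₃ (Set.Iio s) ^ (1 / p')) * m₂ (D k) ^ (1 / p)) ^ q := by
          ring_nf
      _ ≤ (4 * B * m₂ (D k) ^ (1 / p)) ^ q := by
          gcongr
          exact hν s
      _ = (4 * B) ^ q * m₂ (D k) ^ (q / p) := by
          rw [ENNReal.mul_rpow_of_nonneg _ _ hq0.le, ← ENNReal.rpow_mul, one_div_mul_eq_div]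
  -- Each `D k` is covered by two consecutive disjoint shells `E (k - 1)` and `E k`, whence the
  -- factor `2` below. Since `q / p ≥ 1`, the powers can then be summed.
  have hE : ∑' k, m₂ (E k) ≤ m₂ Set.univ := by
    refine (tsum_meas_le_meas_iUnion_of_disjoint m₂ hEm fun i j hij => ?_).trans
      (measure_mono (Set.subset_univ _))
    exact Disjoint.preimage H (hem.pairwise_disjoint_on_Ioc_succ hij)
  have hDs : ∑' k, m₂ (D k) ≤ 2 * m₂ Set.univ := by
    calc ∑' k, m₂ (D k) ≤ ∑' k, (m₂ (E (k - 1)) + m₂ (E k)) := by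
          refine ENNReal.tsum_le_tsum fun k => le_trans (measure_mono fun x hx => ?_)
            (measure_union_le _ _)
          rcases le_or_gt (H x) (e k) with h | h
          · exact Or.inl ⟨hx.1, by rwa [sub_add_cancel]⟩
          · exact Or.inr ⟨h, hx.2⟩
      _ = ∑' k, m₂ (E k) + ∑' k, m₂ (E k) := by
          rw [ENNReal.tsum_add, show ∑' k, m₂ (E (k - 1)) = ∑' k, m₂ (E k) from
            (Equiv.subRight (1 : ℤ)).tsum_eq (fun k => m₂ (E k))]
      _ ≤ 2 * m₂ Set.univ := by
          rw [two_mul]; gcongr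
  calc ∫⁻ s, G s ^ q ∂ν
      ≤ ∫⁻ s, ∑' k, (S k).indicator (fun _ => e (k + 1) ^ q) s ∂ν := lintegral_mono_ae hpt
    _ = ∑' k, e (k + 1) ^ q * ν (S k) := by
        rw [lintegral_tsum fun k => (measurable_const.indicator (hSm k)).aemeasurable]
        simp_rw [lintegral_indicator_const (hSm _)]
    _ ≤ ∑' k, (4 * B) ^ q * m₂ (D k) ^ (q / p) := ENNReal.tsum_le_tsum hterm
    _ ≤ (4 * B) ^ q * (∑' k, m₂ (D k)) ^ (q / p) := by
        rw [ENNReal.tsum_mul_left]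
        gcongr
        exact ENNReal.tsum_rpow_le_rpow_tsum _ (by rwa [one_le_div hp0])
    _ ≤ (4 * B) ^ q * (2 * m₂ Set.univ) ^ (q / p) := by gcongr

/-- Pushing densities forward by `τ` and `ρ` turns `{τ x < ρ y}` into a half-line. One statement
thus covers `x < 1/y` and, after a reflection, `x > 1/y`. -/
theorem lintegral_setLIntegral_lt_rpow_le {p p' q : ℝ} (hp : p.HolderConjugate p') (hpq : p ≤ q)
    {μ : Measure ℝ} {τ ρ : ℝ → ℝ} (hτ : Measurable τ) (hρ : Measurable ρ)
    {h V U : ℝ → ℝ≥0∞} (hh : AEMeasurable h μ) (hV : AEMeasurable V μ) (hU : AEMeasurable U μ)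
    {B : ℝ≥0∞} (hB : B ≠ ⊤) (hfin : ∫⁻ x, h x ^ p ∂μ ≠ ⊤)
    (hUV : ∀ s, (∫⁻ y in {y | s ≤ ρ y}, U y ^ q ∂μ) ^ (1 / q) *
      (∫⁻ x in {x | τ x < s}, V x ^ p' ∂μ) ^ (1 / p') ≤ B) :
    (∫⁻ y, (U y * ∫⁻ x in {x | τ x < ρ y}, h x * V x ∂μ) ^ q ∂μ) ^ (1 / q) ≤
      4 * B * (2 * ∫⁻ x, h x ^ p ∂μ) ^ (1 / p) := by
  have hq0 : 0 < q := hp.pos.trans_le hpq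
  set m₁ := (μ.withDensity fun x => h x * V x).map τ with hm₁
  set m₂ := (μ.withDensity fun x => h x ^ p).map τ with hm₂
  set m₃ := (μ.withDensity fun x => V x ^ p').map τ with hm₃
  set ν := (μ.withDensity fun x => U x ^ q).map ρ with hν
  have a₁ : ∀ E, MeasurableSet E → m₁ E = ∫⁻ x in τ ⁻¹' E, h x * V x ∂μ := fun E hE => by
    rw [hm₁, Measure.map_apply hτ hE, withDensity_apply _ (hτ hE)]
  have a₂ : ∀ E, MeasurableSet E → m₂ E = ∫⁻ x in τ ⁻¹' E, h x ^ p ∂μ := fun E hE => by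
    rw [hm₂, Measure.map_apply hτ hE, withDensity_apply _ (hτ hE)]
  have a₃ : ∀ E, MeasurableSet E → m₃ E = ∫⁻ x in τ ⁻¹' E, V x ^ p' ∂μ := fun E hE => by
    rw [hm₃, Measure.map_apply hτ hE, withDensity_apply _ (hτ hE)]
  have a₄ : ∀ E, MeasurableSet E → ν E = ∫⁻ x in ρ ⁻¹' E, U x ^ q ∂μ := fun E hE => by
    rw [hν, Measure.map_apply hρ hE, withDensity_apply _ (hρ hE)]
  have hu : m₂ Set.univ = ∫⁻ x, h x ^ p ∂μ := by
    rw [a₂ _ MeasurableSet.univ, Set.preimage_univ, setLIntegral_univ]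
  have key := lintegral_measure_Iio_rpow_le hp hpq (m₁ := m₁) (m₂ := m₂) (m₃ := m₃) (ν := ν) hB
    (by rwa [hu]) (fun E hE => by
      rw [a₁ E hE, a₂ E hE, a₃ E hE]
      exact ENNReal.lintegral_mul_le_Lp_mul_Lq _ hp hh.restrict hV.restrict)
    (fun s => by
      rw [a₄ _ measurableSet_Ici, a₃ _ measurableSet_Iio]
      exact hUV s)
  rw [hu] at key
  rw [one_div, ENNReal.rpow_inv_le_iff hq0, ENNReal.mul_rpow_of_nonneg _ _ hq0.le,
    ← ENNReal.rpow_mul, one_div_mul_eq_div]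
  refine le_trans (le_of_eq ?_) key
  have hmono : Monotone fun s => m₁ (Set.Iio s) := fun a b hab =>
    measure_mono (Set.Iio_subset_Iio hab)
  rw [hν, lintegral_map (hmono.measurable.pow_const q) hρ]
  change _ = ∫⁻ a, ((fun s => m₁ (Set.Iio s) ^ q) ∘ ρ) a ∂_
  rw [lintegral_withDensity_eq_lintegral_mul₀ (hU.pow_const q)
      ((hmono.measurable.pow_const q).comp hρ).aemeasurable]
  refine lintegral_congr fun y => ?_
  change _ = U y ^ q * m₁ (Set.Iio (ρ y)) ^ q
  rw [a₁ _ measurableSet_Iio, ENNReal.mul_rpow_of_nonneg _ _ hq0.le]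
  rfl

theorem measurable_setLIntegral_lt {μ : Measure ℝ} (τ : ℝ → ℝ) {ρ : ℝ → ℝ} (hρ : Measurable ρ)
    (F : ℝ → ℝ≥0∞) : Measurable fun y => ∫⁻ x in {x | τ x < ρ y}, F x ∂μ := by
  have hmono : Monotone fun s => ∫⁻ x in {x | τ x < s}, F x ∂μ := fun a b hab =>
    lintegral_mono_set fun x hx => lt_of_lt_of_le hx hab
  exact hmono.measurable.comp hρ

theorem setLIntegral_rpow_le_const_mul {μ : Measure ℝ} {S : Set ℝ} (hS : MeasurableSet S)
    {U W : ℝ → ℝ≥0∞} {c : ℝ≥0∞} (hc : c ≠ ⊤) {q : ℝ} (hq : 0 < q)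
    (h : ∀ᵐ x ∂μ, x ∈ S → U x ≤ c * W x) :
    (∫⁻ x in S, U x ^ q ∂μ) ^ (1 / q) ≤ c * (∫⁻ x, W x ^ q ∂μ) ^ (1 / q) := by
  rw [one_div, ENNReal.rpow_inv_le_iff hq, ENNReal.mul_rpow_of_nonneg _ _ hq.le,
    ENNReal.rpow_inv_rpow hq.ne', ← lintegral_const_mul' _ _ (ENNReal.rpow_ne_top_of_nonneg hq.le hc)]
  refine le_trans (lintegral_mono_ae ((ae_restrict_iff' hS).2 ?_)) (setLIntegral_le_lintegral S _)
  filter_upwards [h] with x hx hxS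
  rw [← ENNReal.mul_rpow_of_nonneg _ _ hq.le]
  exact ENNReal.rpow_le_rpow (hx hxS) hq.le

/-! ### Stieltjes weights -/

/-- The function `x^a / (r + x²)`. -/
noncomputable def stieltjesWeight (a r x : ℝ) : ℝ := x ^ a / (r + x ^ 2)

theorem measurable_stieltjesWeight (a r : ℝ) : Measurable (stieltjesWeight a r) := by
  unfold stieltjesWeight
  fun_prop

theorem stieltjesWeight_pos {a r x : ℝ} (hr : 0 < r) (hx : 0 < x) : 0 < stieltjesWeight a r x := by
  unfold stieltjesWeight
  positivity

theorem rpow_le_mul_stieltjesWeight {a r x : ℝ} (hr : 0 < r) (hx : 0 < x) (h : x ^ 2 ≤ r) :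
    x ^ a ≤ 2 * r * stieltjesWeight a r x := by
  unfold stieltjesWeight
  rw [← mul_div_assoc, le_div_iff₀ (by positivity), mul_comm]
  gcongr
  linarith

theorem rpow_sub_two_le_mul_stieltjesWeight {a r x : ℝ} (hr : 0 < r) (hx : 0 < x) (h : r ≤ x ^ 2) :
    x ^ (a - 2) ≤ 2 * stieltjesWeight a r x := by
  unfold stieltjesWeight
  rw [← mul_div_assoc, le_div_iff₀ (by positivity), Real.rpow_sub hx, Real.rpow_two,
    div_mul_eq_mul_div, div_le_iff₀ (by positivity), mul_comm 2, mul_assoc]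
  gcongr
  linarith

/-- Expanding `(t⁻² + y²)(t² + x²)` gives `1 + (xy)²` plus nonnegative terms. This rank-one minorant
of the model kernel drives necessity. -/
theorem stieltjesWeight_mul_le {a t x y : ℝ} (ht : 0 < t) (hx : 0 < x) (hy : 0 < y) :
    stieltjesWeight a (t ^ (-2 : ℤ)) y * stieltjesWeight a (t ^ 2) x ≤
      (x * y) ^ a / (1 + (x * y) ^ 2) := by
  unfold stieltjesWeight
  have e : t ^ (-2 : ℤ) = (t ^ 2)⁻¹ := by rw [zpow_neg]; rfl
  rw [e, div_mul_div_comm, Real.mul_rpow hx.le hy.le, mul_comm (y ^ a)]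
  gcongr
  have : ((t ^ 2)⁻¹ + y ^ 2) * (t ^ 2 + x ^ 2) =
      1 + (x * y) ^ 2 + (t ^ 2)⁻¹ * x ^ 2 + y ^ 2 * t ^ 2 := by
    field_simp
    ring
  rw [this]
  have h1 : 0 ≤ (t ^ 2)⁻¹ * x ^ 2 := by positivity
  have h2 : 0 ≤ y ^ 2 * t ^ 2 := by positivity
  linarith

/-! ### Sufficiency -/

theorem IsWeight.aemeasurable {u : ℝ → ℝ} (hu : IsWeight u) :
    AEMeasurable u (volume.restrict (Set.Ioi 0)) :=
  hu.locallyIntegrable.aestronglyMeasurable.aemeasurable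

theorem measurable_struveKernel (α y : ℝ) : Measurable fun x => struveKernel α x y := by
  unfold struveKernel
  have h : Measurable fun x : ℝ => struveH α (x * y) :=
    (measurable_struveH α).comp (measurable_id.mul_const y)
  exact Measurable.mul (by fun_prop) h

theorem HasStruveTransform.tendsto {𝕜 : Type*} [RCLike 𝕜] {α : ℝ} {f : ℝ → 𝕜}
    (hf : HasStruveTransform α f) {y : ℝ} (hy : 0 < y) :
    Tendsto (truncatedStruveTransform α f y) atTop (𝓝 (struveTransform α f y)) :=
  tendsto_nhds_limUnder (hf.converges y hy)

theorem HasStruveTransform.enorm_struveTransform_le {𝕜 : Type*} [RCLike 𝕜] {α : ℝ} {f : ℝ → 𝕜}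
    (hf : HasStruveTransform α f) {y : ℝ} (hy : 0 < y) :
    ‖struveTransform α f y‖ₑ ≤ ∫⁻ x in Set.Ioi 0, ‖struveKernel α x y • f x‖ₑ := by
  refine le_of_tendsto' (hf.tendsto hy).enorm fun N => ?_
  exact (enorm_integral_le_lintegral_enorm _).trans
    (lintegral_mono_set Set.Ioc_subset_Ioi_self)

theorem weightedNorm_eq {𝕜 : Type*} [RCLike 𝕜] (p : ℝ) {v : ℝ → ℝ} (hv : IsWeight v)
    (hp : 0 < p) (f : ℝ → 𝕜) :
    weightedNorm p v f =
      (∫⁻ x in Set.Ioi 0, ENNReal.ofReal (v x * ‖f x‖) ^ p) ^ (1 / p) := by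
  unfold weightedNorm
  congr 1
  refine setLIntegral_congr_fun measurableSet_Ioi fun x hx => ?_
  have := (hv.pos x hx).le
  rw [ENNReal.ofReal_rpow_of_nonneg (by positivity) hp.le,
    Real.mul_rpow this (norm_nonneg _)]

/-- Each of the two Hardy pieces has Muckenhoupt constant at most `4 B`, the `4` coming from two
comparisons with Stieltjes weights. The Hardy inequality contributes another `4` and `2^(1/p)`;
adding both pieces gives `32`. -/
theorem weightedNorm_struveTransform_le {𝕜 : Type*} [RCLike 𝕜] {p p' q α : ℝ}
    (hp : p.HolderConjugate p') (hpq : p ≤ q) {u v : ℝ → ℝ} (hu : IsWeight u) (hv : IsWeight v)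
    {C : ℝ} (hC : 0 < C)
    (hker : ∀ s : ℝ, 0 < s →
      s ^ (1 / 2 : ℝ) * struveH α s ≤ C * (s ^ (α + 3 / 2) / (1 + s ^ 2)))
    (hker0 : ∀ s : ℝ, 0 < s → 0 ≤ s ^ (1 / 2 : ℝ) * struveH α s)
    {B : ℝ≥0∞} (hB : B ≠ ⊤)
    (hUV : ∀ t : ℝ, 0 < t →
      (∫⁻ y in Set.Ioi (0 : ℝ), ENNReal.ofReal (stieltjesWeight (α + 3 / 2) (t ^ (-2 : ℤ)) y * u y)
        ^ q) ^ (1 / q) *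
      (∫⁻ x in Set.Ioi (0 : ℝ), ENNReal.ofReal (stieltjesWeight (α + 3 / 2) (t ^ 2) x * (v x)⁻¹)
        ^ p') ^ (1 / p') ≤ B)
    {f : ℝ → 𝕜} (hf : HasStruveTransform α f) (hfin : weightedNorm p v f ≠ ⊤) :
    weightedNorm q u (struveTransform α f) ≤
      ENNReal.ofReal C * (32 * B * 2 ^ (1 / p)) * weightedNorm p v f := by
  have hp0 := hp.pos
  have hp'0 := hp.symm.pos
  have hq0 : 0 < q := hp0.trans_le hpq
  set a := α + 3 / 2 with ha
  set μ := volume.restrict (Set.Ioi (0 : ℝ)) with hμ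
  have hpos : ∀ᵐ x ∂μ, 0 < x := ae_restrict_mem measurableSet_Ioi
  have hum := hu.aemeasurable
  have hvm := hv.aemeasurable
  have hfm := hf.measurable.norm.aemeasurable
  set h : ℝ → ℝ≥0∞ := fun x => ENNReal.ofReal (v x * ‖f x‖) with hh
  have hhm : AEMeasurable h μ := (hvm.mul hfm).ennreal_ofReal
  have hN : weightedNorm p v f = (∫⁻ x, h x ^ p ∂μ) ^ (1 / p) := weightedNorm_eq p hv hp0 f
  have hNfin : ∫⁻ x, h x ^ p ∂μ ≠ ⊤ := by
    intro htop
    rw [hN, htop, ENNReal.top_rpow_of_pos (by positivity)] at hfin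
    exact hfin rfl
  have h4B : 4 * B ≠ ⊤ := ENNReal.mul_ne_top (by simp) hB
  let U : ℝ → ℝ → ℝ≥0∞ := fun b y => ENNReal.ofReal (y ^ b * u y)
  let V : ℝ → ℝ → ℝ≥0∞ := fun b x => ENNReal.ofReal (x ^ b * (v x)⁻¹)
  have hUm : ∀ b, AEMeasurable (U b) μ := fun b =>
    ((by fun_prop : Measurable fun y : ℝ => y ^ b).aemeasurable.mul hum).ennreal_ofReal
  have hVm : ∀ b, AEMeasurable (V b) μ := fun b =>
    ((by fun_prop : Measurable fun y : ℝ => y ^ b).aemeasurable.mul hvm.inv).ennreal_ofReal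
  have hinv : Measurable fun y : ℝ => y⁻¹ := measurable_inv
  have hninv : Measurable fun y : ℝ => -y⁻¹ := measurable_inv.neg
  have hlow := lintegral_setLIntegral_lt_rpow_le hp hpq (μ := μ) (τ := fun x => x)
    (ρ := fun y => y⁻¹) measurable_id hinv hhm (hVm a) (hUm a) h4B hNfin fun s => by
      -- The Hardy lemma asks for all real cuts; for `s ≤ 0` the inner set misses `(0, ∞)`. For `s >
      -- 0` the hypothesis is used at `t = s`.
      rcases le_or_gt s 0 with hs | hs
      · have : ∫⁻ x in {x | x < s}, V a x ^ p' ∂μ = 0 := by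
          rw [Measure.restrict_eq_zero.2, lintegral_zero_measure]
          rw [← compl_compl {x : ℝ | x < s}, ← mem_ae_iff]
          filter_upwards [hpos] with x hx
          change ¬ x < s
          linarith
        rw [this, ENNReal.zero_rpow_of_pos (by positivity), mul_zero]
        exact zero_le
      · have e : s ^ (-2 : ℤ) = (s ^ 2)⁻¹ := by rw [zpow_neg]; rfl
        have k1 := setLIntegral_rpow_le_const_mul (μ := μ) (S := {y | s ≤ y⁻¹})
          (measurableSet_le measurable_const hinv) (U := U a)
          (W := fun y => ENNReal.ofReal (stieltjesWeight a (s ^ (-2 : ℤ)) y * u y))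
          (c := ENNReal.ofReal (2 * (s ^ 2)⁻¹)) ENNReal.ofReal_ne_top hq0 (by
            filter_upwards [hpos] with y hy hys
            rw [← ENNReal.ofReal_mul (by positivity), ← mul_assoc, e]
            have := (hu.pos y hy).le
            refine ENNReal.ofReal_le_ofReal ?_
            gcongr
            refine rpow_le_mul_stieltjesWeight (by positivity) hy ?_
            rw [← inv_pow]
            gcongr
            exact (le_inv_comm₀ hs hy).1 hys)
        have k2 := setLIntegral_rpow_le_const_mul (μ := μ) (S := {x | x < s})
          measurableSet_Iio (U := V a)
          (W := fun x => ENNReal.ofReal (stieltjesWeight a (s ^ 2) x * (v x)⁻¹))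
          (c := ENNReal.ofReal (2 * s ^ 2)) ENNReal.ofReal_ne_top hp'0 (by
            filter_upwards [hpos] with x hx hxs
            rw [← ENNReal.ofReal_mul (by positivity), ← mul_assoc]
            have := (hv.pos x hx).le
            refine ENNReal.ofReal_le_ofReal ?_
            gcongr
            refine rpow_le_mul_stieltjesWeight (by positivity) hx ?_
            have : x < s := hxs
            gcongr)
        refine (mul_le_mul' k1 k2).trans ?_
        rw [mul_mul_mul_comm, ← ENNReal.ofReal_mul (by positivity)]
        have e4 : 2 * (s ^ 2)⁻¹ * (2 * s ^ 2) = 4 := by field_simp; norm_num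
        rw [e4, ENNReal.ofReal_ofNat]
        gcongr
        exact hUV s hs
  have hupp := lintegral_setLIntegral_lt_rpow_le hp hpq (μ := μ) (τ := fun x => -x)
    (ρ := fun y => -y⁻¹) measurable_neg hninv hhm (hVm (a - 2)) (hUm (a - 2)) h4B hNfin fun s => by
      rcases le_or_gt 0 s with hs | hs
      · have : ∫⁻ x in {y | s ≤ -y⁻¹}, U (a - 2) x ^ q ∂μ = 0 := by
          rw [Measure.restrict_eq_zero.2, lintegral_zero_measure]
          rw [← compl_compl {y : ℝ | s ≤ -y⁻¹}, ← mem_ae_iff]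
          filter_upwards [hpos] with x hx
          have : 0 < x⁻¹ := by positivity
          change ¬ s ≤ -x⁻¹
          linarith
        rw [this, ENNReal.zero_rpow_of_pos (by positivity), zero_mul]
        exact zero_le
      · obtain ⟨r, rfl⟩ : ∃ r, s = -r := ⟨-s, by ring⟩
        have hr : 0 < r := by linarith
        have e : r ^ (-2 : ℤ) = (r ^ 2)⁻¹ := by rw [zpow_neg]; rfl
        have k1 := setLIntegral_rpow_le_const_mul (μ := μ) (S := {y | -r ≤ -y⁻¹})
          (measurableSet_le measurable_const hninv) (U := U (a - 2))
          (W := fun y => ENNReal.ofReal (stieltjesWeight a (r ^ (-2 : ℤ)) y * u y))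
          (c := ENNReal.ofReal 2) ENNReal.ofReal_ne_top hq0 (by
            filter_upwards [hpos] with y hy hys
            rw [← ENNReal.ofReal_mul (by positivity), ← mul_assoc, e]
            have := (hu.pos y hy).le
            refine ENNReal.ofReal_le_ofReal ?_
            gcongr
            refine rpow_sub_two_le_mul_stieltjesWeight (by positivity) hy ?_
            rw [← inv_pow]
            gcongr
            exact (inv_le_comm₀ hr hy).2 (neg_le_neg_iff.1 hys))
        have k2 := setLIntegral_rpow_le_const_mul (μ := μ) (S := {x | -x < -r})
          (measurableSet_lt measurable_neg measurable_const) (U := V (a - 2))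
          (W := fun x => ENNReal.ofReal (stieltjesWeight a (r ^ 2) x * (v x)⁻¹))
          (c := ENNReal.ofReal 2) ENNReal.ofReal_ne_top hp'0 (by
            filter_upwards [hpos] with x hx hxs
            rw [← ENNReal.ofReal_mul (by positivity), ← mul_assoc]
            have := (hv.pos x hx).le
            refine ENNReal.ofReal_le_ofReal ?_
            gcongr
            refine rpow_sub_two_le_mul_stieltjesWeight (by positivity) hx ?_
            have : r < x := neg_lt_neg_iff.1 hxs
            gcongr)
        refine (mul_le_mul' k1 k2).trans ?_
        rw [mul_mul_mul_comm, ← ENNReal.ofReal_mul (by positivity)]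
        norm_num only
        rw [ENNReal.ofReal_ofNat]
        gcongr
        exact hUV r hr
  set P : ℝ → ℝ≥0∞ := fun y => U a y * ∫⁻ x in {x | x < y⁻¹}, h x * V a x ∂μ with hP
  set Q : ℝ → ℝ≥0∞ := fun y => U (a - 2) y * ∫⁻ x in {x | -x < -y⁻¹}, h x * V (a - 2) x ∂μ with hQ
  have hPm : AEMeasurable P μ :=
    (hUm a).mul (measurable_setLIntegral_lt (fun x => x) hinv _).aemeasurable
  have hQm : AEMeasurable Q μ :=
    (hUm (a - 2)).mul (measurable_setLIntegral_lt (fun x => -x) hninv _).aemeasurable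
  have hpt : ∀ᵐ y ∂μ, ENNReal.ofReal (u y * ‖struveTransform α f y‖) ≤
      ENNReal.ofReal C * (P y + Q y) := by
    filter_upwards [hpos] with y hy
    have huy := hu.pos y hy
    -- The two strict regions omit only the null point `x = 1/y`.
    have hne : ∀ᵐ x ∂μ, x ≠ y⁻¹ := by
      refine ae_restrict_of_ae ?_
      exact Measure.ae_ne volume y⁻¹
    have hx : ∀ᵐ x ∂μ, ENNReal.ofReal (u y) * ‖struveKernel α x y • f x‖ₑ ≤
        ENNReal.ofReal C *
        ({x | x < y⁻¹}.indicator (fun x => U a y * (h x * V a x)) x +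
          {x | -x < -y⁻¹}.indicator (fun x => U (a - 2) y * (h x * V (a - 2) x)) x) := by
      filter_upwards [hpos, hne] with x hx hxne
      have hvx := hv.pos x hx
      have hxy : 0 < x * y := by positivity
      have hk := hker (x * y) hxy
      have hk0 : 0 ≤ struveKernel α x y := hker0 _ hxy
      have hkey : ∀ b, (x * y) ^ a / (1 + (x * y) ^ 2) ≤ (x * y) ^ b →
          ENNReal.ofReal (u y) * ‖struveKernel α x y • f x‖ₑ ≤
            ENNReal.ofReal C * (U b y * (h x * V b x)) := by
        intro b hb
        rw [enorm_smul, Real.enorm_of_nonneg hk0, ← ofReal_norm (f x),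
          ← ENNReal.ofReal_mul hk0, ← ENNReal.ofReal_mul huy.le,
          ← ENNReal.ofReal_mul (by positivity), ← ENNReal.ofReal_mul (by positivity),
          ← ENNReal.ofReal_mul (by positivity)]
        refine ENNReal.ofReal_le_ofReal ?_
        calc u y * (struveKernel α x y * ‖f x‖)
            ≤ u y * (C * (x * y) ^ b * ‖f x‖) := by
              gcongr
              exact hk.trans (by gcongr)
          _ = C * (y ^ b * u y * (v x * ‖f x‖ * (x ^ b * (v x)⁻¹))) := by
              rw [Real.mul_rpow hx.le hy.le]
              field_simp
      rcases lt_or_gt_of_ne hxne with hlt | hgt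
      · rw [Set.indicator_of_mem (show x ∈ {x | x < y⁻¹} from hlt)]
        refine (hkey a ?_).trans (by gcongr; exact le_self_add)
        exact div_le_self (by positivity) (by nlinarith)
      · rw [Set.indicator_of_mem (show x ∈ {x | -x < -y⁻¹} from neg_lt_neg hgt)]
        refine (hkey (a - 2) ?_).trans (by gcongr; exact le_add_self)
        rw [Real.rpow_sub hxy, Real.rpow_two]
        gcongr
        linarith
    have hUa : ∀ b, U b y ≠ ⊤ := fun b => ENNReal.ofReal_ne_top
    calc ENNReal.ofReal (u y * ‖struveTransform α f y‖)
        = ENNReal.ofReal (u y) * ‖struveTransform α f y‖ₑ := by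
          rw [ENNReal.ofReal_mul huy.le, ofReal_norm]
      _ ≤ ENNReal.ofReal (u y) * ∫⁻ x, ‖struveKernel α x y • f x‖ₑ ∂μ := by
          gcongr
          exact hf.enorm_struveTransform_le hy
      _ = ∫⁻ x, ENNReal.ofReal (u y) * ‖struveKernel α x y • f x‖ₑ ∂μ :=
          (lintegral_const_mul' _ _ ENNReal.ofReal_ne_top).symm
      _ ≤ _ := lintegral_mono_ae hx
      _ = ENNReal.ofReal C * (P y + Q y) := by
          rw [lintegral_const_mul' _ _ ENNReal.ofReal_ne_top, lintegral_add_left',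
            lintegral_indicator (measurableSet_lt measurable_id' measurable_const),
            lintegral_indicator (measurableSet_lt measurable_neg measurable_const),
            lintegral_const_mul' _ _ (hUa _), lintegral_const_mul' _ _ (hUa _)]
          exact ((hhm.mul (hVm a)).const_mul _).indicator measurableSet_Iio
  rw [weightedNorm_eq q hu hq0]
  calc (∫⁻ y, ENNReal.ofReal (u y * ‖struveTransform α f y‖) ^ q ∂μ) ^ (1 / q)
      ≤ (∫⁻ y, (ENNReal.ofReal C * (P y + Q y)) ^ q ∂μ) ^ (1 / q) := by
        refine ENNReal.rpow_le_rpow (lintegral_mono_ae ?_) (by positivity)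
        filter_upwards [hpt] with y hy using ENNReal.rpow_le_rpow hy hq0.le
    _ = ENNReal.ofReal C * (∫⁻ y, ((P + Q) y) ^ q ∂μ) ^ (1 / q) := by
        simp_rw [ENNReal.mul_rpow_of_nonneg _ _ hq0.le]
        rw [lintegral_const_mul' _ _ (ENNReal.rpow_ne_top_of_nonneg hq0.le ENNReal.ofReal_ne_top),
          ENNReal.mul_rpow_of_nonneg _ _ (by positivity), ← ENNReal.rpow_mul,
          mul_one_div_cancel hq0.ne', ENNReal.rpow_one]
        rfl
    _ ≤ ENNReal.ofReal C * ((∫⁻ y, P y ^ q ∂μ) ^ (1 / q) + (∫⁻ y, Q y ^ q ∂μ) ^ (1 / q)) := by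
        gcongr
        exact ENNReal.lintegral_Lp_add_le hPm hQm (hp.lt.le.trans hpq)
    _ ≤ ENNReal.ofReal C * (4 * (4 * B) * (2 * ∫⁻ x, h x ^ p ∂μ) ^ (1 / p) +
          4 * (4 * B) * (2 * ∫⁻ x, h x ^ p ∂μ) ^ (1 / p)) := by
        gcongr
    _ = ENNReal.ofReal C * (32 * B * 2 ^ (1 / p)) * weightedNorm p v f := by
        rw [hN, ENNReal.mul_rpow_of_nonneg _ _ (by positivity : 0 ≤ 1 / p)]
        ring

/-! ### Necessity -/

/-- Truncated extremal function for the duality between `L_p` and `L_{p'}`. -/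
noncomputable def dualTestFunction (ψ v : ℝ → ℝ) (p' : ℝ) (n : ℕ) : ℝ → ℝ :=
  (Set.Ioo 0 (n : ℝ)).indicator fun x => ψ x ^ (p' - 1) * min (v x ^ (-p')) n

section dualTestFunction

variable {ψ v : ℝ → ℝ} {p p' : ℝ}

theorem dualTestFunction_nonneg (hψ : ∀ x, 0 < x → 0 < ψ x) (hv : IsWeight v) (n : ℕ) (x : ℝ) :
    0 ≤ dualTestFunction ψ v p' n x := by
  refine Set.indicator_nonneg (fun x hx => ?_) x
  exact mul_nonneg (Real.rpow_nonneg (hψ x hx.1).le _)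
    (le_min (Real.rpow_nonneg (hv.pos x hx.1).le _) n.cast_nonneg)

theorem aestronglyMeasurable_dualTestFunction (hψm : Measurable ψ) (hv : IsWeight v) (n : ℕ) :
    AEStronglyMeasurable (dualTestFunction ψ v p' n) volume := by
  refine (aestronglyMeasurable_indicator_iff measurableSet_Ioo).2 ?_
  have hvm : AEMeasurable v (volume.restrict (Set.Ioo 0 (n : ℝ))) :=
    hv.aemeasurable.mono_set Set.Ioo_subset_Ioi_self
  exact (((hψm.pow_const _).aemeasurable).mul
    ((hvm.pow_const _).min aemeasurable_const)).aestronglyMeasurable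

theorem mul_dualTestFunction (hψ : ∀ x, 0 < x → 0 < ψ x) {n : ℕ} {x : ℝ} (hx : 0 < x)
    (hxn : x < n) :
    ψ x * dualTestFunction ψ v p' n x = ψ x ^ p' * min (v x ^ (-p')) n := by
  rw [dualTestFunction, Set.indicator_of_mem (show x ∈ Set.Ioo 0 (n : ℝ) from ⟨hx, hxn⟩),
    Real.rpow_sub_one (hψ x hx).ne', ← mul_assoc, mul_div_cancel₀ _ (hψ x hx).ne']

theorem monotone_dualTestFunction (hψ : ∀ x, 0 < x → 0 < ψ x) (hv : IsWeight v) (x : ℝ) :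
    Monotone fun n => dualTestFunction ψ v p' n x := by
  intro m n hmn
  have hmn' : (m : ℝ) ≤ n := Nat.cast_le.2 hmn
  by_cases hx : x ∈ Set.Ioo 0 (m : ℝ)
  · have hx' : x ∈ Set.Ioo 0 (n : ℝ) := ⟨hx.1, hx.2.trans_le hmn'⟩
    simp only [dualTestFunction, Set.indicator_of_mem hx, Set.indicator_of_mem hx']
    have := hψ x hx.1
    gcongr
  · simp only [dualTestFunction, Set.indicator_of_notMem hx]
    exact dualTestFunction_nonneg hψ hv n x

/-- Without truncation this is the equality case of Hölder, since `(p' - 1) p = p'`. The truncated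
factor `m` satisfies `m^(p-1) ≤ v^(-p)`, so one inequality survives. -/
theorem rpow_mul_dualTestFunction_rpow_le (hp : p.HolderConjugate p')
    (hψ : ∀ x, 0 < x → 0 < ψ x) (hv : IsWeight v) (n : ℕ) {x : ℝ} (hx : 0 < x) :
    v x ^ p * dualTestFunction ψ v p' n x ^ p ≤ ψ x * dualTestFunction ψ v p' n x := by
  have hp0 := hp.pos
  by_cases hxn : x < n
  · rw [mul_dualTestFunction hψ hx hxn, dualTestFunction,
      Set.indicator_of_mem (show x ∈ Set.Ioo 0 (n : ℝ) from ⟨hx, hxn⟩)]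
    have hvx := hv.pos x hx
    have hψx := hψ x hx
    have hn : (0 : ℝ) < n := hx.trans hxn
    set m := min (v x ^ (-p')) (n : ℝ) with hm
    have hm0 : 0 < m := lt_min (by positivity) hn
    have e1 : (p' - 1) * p = p' := by
      have := hp.mul_eq_add
      linarith
    have e2 : -p' * (p - 1) = -p := by
      have := hp.mul_eq_add
      linarith
    have h1 : m ^ (p - 1) ≤ v x ^ (-p) := by
      rw [← e2, Real.rpow_mul hvx.le]
      exact Real.rpow_le_rpow hm0.le (min_le_left _ _) hp.sub_one_pos.le
    have h2 : m ^ p = m ^ (p - 1) * m := by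
      rw [Real.rpow_sub_one hm0.ne', div_mul_cancel₀ _ hm0.ne']
    rw [Real.mul_rpow (by positivity) hm0.le, ← Real.rpow_mul hψx.le, e1, h2]
    calc v x ^ p * (ψ x ^ p' * (m ^ (p - 1) * m))
        ≤ v x ^ p * (ψ x ^ p' * (v x ^ (-p) * m)) := by gcongr
      _ = ψ x ^ p' * m := by
        rw [Real.rpow_neg hvx.le]
        field_simp
  · rw [dualTestFunction, Set.indicator_of_notMem (fun h => hxn h.2), Real.zero_rpow hp0.ne']
    simp

theorem tendsto_lintegral_mul_dualTestFunction (hψ : ∀ x, 0 < x → 0 < ψ x) (hψm : Measurable ψ)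
    (hv : IsWeight v) :
    Tendsto (fun n => ∫⁻ x in Set.Ioi 0, ENNReal.ofReal (ψ x * dualTestFunction ψ v p' n x)) atTop
      (𝓝 (∫⁻ x in Set.Ioi 0, ENNReal.ofReal (ψ x ^ p' * v x ^ (-p')))) := by
  refine lintegral_tendsto_of_tendsto_of_monotone (fun n => ?_) ?_ ?_
  · exact (hψm.aemeasurable.mul
      (aestronglyMeasurable_dualTestFunction hψm hv n).aemeasurable.restrict).ennreal_ofReal
  · filter_upwards [ae_restrict_mem measurableSet_Ioi] with x hx m n hmn
    refine ENNReal.ofReal_le_ofReal ?_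
    exact mul_le_mul_of_nonneg_left (monotone_dualTestFunction hψ hv x hmn) (hψ x hx).le
  · filter_upwards [ae_restrict_mem measurableSet_Ioi] with x hx
    refine tendsto_const_nhds.congr' ?_
    obtain ⟨N, hN⟩ := exists_nat_gt (max x (v x ^ (-p')))
    filter_upwards [eventually_ge_atTop N] with n hn
    have hNn : (N : ℝ) ≤ n := Nat.cast_le.2 hn
    have h1 := (max_lt_iff.1 hN).1
    have h2 := (max_lt_iff.1 hN).2
    rw [mul_dualTestFunction hψ hx (h1.trans_le hNn), min_eq_left (h2.le.trans hNn)]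

end dualTestFunction

/-- Truncation makes the test function bounded with bounded support, and the kernel is bounded on
that support, so no integrability of `v^(-p')` is needed. -/
theorem integrable_struveKernel_mul_dualTestFunction {p' α C : ℝ} (hp' : 1 < p') (hα : 1 / 2 < α)
    (hC : 0 < C)
    (hker : ∀ s : ℝ, 0 < s →
      s ^ (1 / 2 : ℝ) * struveH α s ≤ C * (s ^ (α + 3 / 2) / (1 + s ^ 2)))
    (hker0 : ∀ s : ℝ, 0 < s → 0 ≤ s ^ (1 / 2 : ℝ) * struveH α s)
    {v : ℝ → ℝ} (hv : IsWeight v) {t : ℝ} (ht : 0 < t) (n : ℕ) {y : ℝ} (hy : 0 < y) :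
    Integrable fun x => struveKernel α x y *
      dualTestFunction (stieltjesWeight (α + 3 / 2) (t ^ 2)) v p' n x := by
  set ψ := stieltjesWeight (α + 3 / 2) (t ^ 2) with hψdef
  have hψ : ∀ x, 0 < x → 0 < ψ x := fun x hx => stieltjesWeight_pos (by positivity) hx
  have hψm : Measurable ψ := measurable_stieltjesWeight _ _
  have e : (fun x => struveKernel α x y * dualTestFunction ψ v p' n x) =
      (Set.Ioo 0 (n : ℝ)).indicator
        (fun x => struveKernel α x y * dualTestFunction ψ v p' n x) := by
    rw [eq_comm, Set.indicator_eq_self]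
    intro x hx
    by_contra h
    exact hx (by simp [dualTestFunction, Set.indicator_of_notMem h])
  rw [e, integrable_indicator_iff measurableSet_Ioo]
  refine Measure.integrableOn_of_bounded (by simp)
    ((measurable_struveKernel α y).aestronglyMeasurable.mul
      (aestronglyMeasurable_dualTestFunction hψm hv n))
    (M := C * (n * y) ^ (α + 3 / 2) * (((n : ℝ) ^ (α + 3 / 2) / t ^ 2) ^ (p' - 1) * n)) ?_
  filter_upwards [ae_restrict_mem measurableSet_Ioo] with x hx
  have hx0 : 0 < x := hx.1
  have hn : (0 : ℝ) < n := hx0.trans hx.2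
  have hxy : 0 < x * y := by positivity
  have hk0 : 0 ≤ struveKernel α x y := hker0 _ hxy
  have hk : struveKernel α x y ≤ C * (n * y) ^ (α + 3 / 2) := by
    refine (hker _ hxy).trans ?_
    gcongr
    refine (div_le_self (by positivity) (by nlinarith)).trans ?_
    have := hx.2.le
    gcongr
  rw [Real.norm_of_nonneg (mul_nonneg hk0 (dualTestFunction_nonneg hψ hv n x))]
  refine mul_le_mul hk ?_ (dualTestFunction_nonneg hψ hv n x) (by positivity)
  rw [dualTestFunction, Set.indicator_of_mem hx]
  have hψx := hψ x hx0
  have hvx := hv.pos x hx0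
  have hp1 : 0 ≤ p' - 1 := by linarith
  refine mul_le_mul (Real.rpow_le_rpow hψx.le ?_ hp1) (min_le_right _ _)
    (le_min (by positivity) hn.le) (by positivity)
  rw [hψdef, stieltjesWeight]
  have := hx.2.le
  gcongr
  nlinarith

theorem hasStruveTransform_ofReal {𝕜 : Type*} [RCLike 𝕜] {α : ℝ} {g : ℝ → ℝ} {R : ℝ}
    (hgm : AEStronglyMeasurable g volume) (hg : ∀ x, R ≤ x → g x = 0)
    (hint : ∀ y, 0 < y → Integrable fun x => struveKernel α x y * g x) :
    HasStruveTransform α (fun x => (g x : 𝕜)) ∧ ∀ y, 0 < y →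
      struveTransform α (fun x => (g x : 𝕜)) y =
        ((∫ x in Set.Ioi 0, struveKernel α x y * g x : ℝ) : 𝕜) := by
  have e : ∀ y, (fun x => struveKernel α x y • (g x : 𝕜)) =
      fun x => ((struveKernel α x y * g x : ℝ) : 𝕜) := fun y => by
    funext x
    rw [RCLike.real_smul_eq_coe_mul, RCLike.ofReal_mul]
  have hlim : ∀ y, 0 < y → Tendsto (truncatedStruveTransform α (fun x => (g x : 𝕜)) y) atTop
      (𝓝 ((∫ x in Set.Ioi 0, struveKernel α x y * g x : ℝ) : 𝕜)) := by
    intro y hy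
    refine tendsto_const_nhds.congr' ?_
    filter_upwards [eventually_ge_atTop R] with N hN
    rw [truncatedStruveTransform, e, integral_ofReal]
    congr 1
    refine (setIntegral_eq_of_subset_of_forall_sdiff_eq_zero measurableSet_Ioi
      Set.Ioc_subset_Ioi_self fun x hx => ?_)
    have : N < x := by
      by_contra h
      exact hx.2 ⟨hx.1, not_lt.1 h⟩
    rw [hg x (hN.trans this.le), mul_zero]
  refine ⟨⟨?_, fun y hy N => ?_, fun y hy => ⟨_, hlim y hy⟩⟩, fun y hy => (hlim y hy).limUnder_eq⟩
  · exact (RCLike.continuous_ofReal.comp_aestronglyMeasurable hgm).restrict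
  · rw [e]
    exact (hint y hy).integrableOn.ofReal

/-- With `Φ` the first factor and `I = ∫ ψ g` for a test function `g`, the rank-one minorant gives
`c Φ I ≤ D I^(1/p)`. Divide by `I^(1/p)` and let the truncation tend to infinity by monotone
convergence. -/
theorem lintegral_stieltjesWeight_mul_le {𝕜 : Type*} [RCLike 𝕜] {p p' q α : ℝ}
    (hp : p.HolderConjugate p') (hpq : p ≤ q) (hα : 1 / 2 < α) {u v : ℝ → ℝ} (hu : IsWeight u)
    (hv : IsWeight v) {c C D : ℝ} (hc : 0 < c) (hC : 0 < C)
    (hker : ∀ s : ℝ, 0 < s → c * (s ^ (α + 3 / 2) / (1 + s ^ 2)) ≤ s ^ (1 / 2 : ℝ) * struveH α s ∧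
      s ^ (1 / 2 : ℝ) * struveH α s ≤ C * (s ^ (α + 3 / 2) / (1 + s ^ 2)))
    (hD : ∀ f : ℝ → 𝕜, HasStruveTransform α f →
      weightedNorm q u (struveTransform α f) ≤ ENNReal.ofReal D * weightedNorm p v f)
    {t : ℝ} (ht : 0 < t) :
    (∫⁻ y in Set.Ioi (0 : ℝ), ENNReal.ofReal (stieltjesWeight (α + 3 / 2) (t ^ (-2 : ℤ)) y * u y)
        ^ q) ^ (1 / q) *
      (∫⁻ x in Set.Ioi (0 : ℝ), ENNReal.ofReal (stieltjesWeight (α + 3 / 2) (t ^ 2) x ^ p' *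
        v x ^ (-p'))) ^ (1 / p') ≤ ENNReal.ofReal (D / c) := by
  have hp0 := hp.pos
  have hp'0 := hp.symm.pos
  have hq0 : 0 < q := hp0.trans_le hpq
  set φ := stieltjesWeight (α + 3 / 2) (t ^ (-2 : ℤ)) with hφdef
  set ψ := stieltjesWeight (α + 3 / 2) (t ^ 2) with hψdef
  have hφ : ∀ x, 0 < x → 0 < φ x := fun x hx => stieltjesWeight_pos (by positivity) hx
  have hψ : ∀ x, 0 < x → 0 < ψ x := fun x hx => stieltjesWeight_pos (by positivity) hx
  have hψm : Measurable ψ := measurable_stieltjesWeight _ _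
  have hker0 : ∀ s : ℝ, 0 < s → 0 ≤ s ^ (1 / 2 : ℝ) * struveH α s := fun s hs =>
    le_trans (by positivity) (hker s hs).1
  set Φ : ℝ≥0∞ := (∫⁻ y in Set.Ioi (0 : ℝ), ENNReal.ofReal (φ y * u y) ^ q) ^ (1 / q) with hΦ
  have main : ∀ n : ℕ, Φ * (∫⁻ x in Set.Ioi 0,
      ENNReal.ofReal (ψ x * dualTestFunction ψ v p' n x)) ^ (1 / p') ≤ ENNReal.ofReal (D / c) := by
    intro n
    set g := dualTestFunction ψ v p' n with hg
    set I := ∫⁻ x in Set.Ioi 0, ENNReal.ofReal (ψ x * g x) with hI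
    have hg0 : ∀ x, 0 ≤ g x := dualTestFunction_nonneg hψ hv n
    have hint : ∀ y, 0 < y → Integrable fun x => struveKernel α x y * g x := fun y hy =>
      integrable_struveKernel_mul_dualTestFunction hp.symm.lt hα hC (fun s hs => (hker s hs).2)
        hker0 hv ht n hy
    obtain ⟨hf, hft⟩ := hasStruveTransform_ofReal (𝕜 := 𝕜) (R := n)
      (aestronglyMeasurable_dualTestFunction hψm hv n)
      (fun x hx => Set.indicator_of_notMem (fun h => absurd h.2 (not_lt.2 hx)) _) hint
    have hlow : ∀ y, 0 < y → ENNReal.ofReal (c * φ y) * I ≤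
        ∫⁻ x in Set.Ioi 0, ENNReal.ofReal (struveKernel α x y * g x) := by
      intro y hy
      rw [hI, ← lintegral_const_mul' _ _ ENNReal.ofReal_ne_top]
      refine setLIntegral_mono' measurableSet_Ioi fun x hx => ?_
      have hx0 : 0 < x := hx
      rw [← ENNReal.ofReal_mul (mul_pos hc (hφ y hy)).le]
      refine ENNReal.ofReal_le_ofReal ?_
      rw [← mul_assoc]
      refine mul_le_mul_of_nonneg_right ?_ (hg0 x)
      rw [mul_assoc]
      refine le_trans ?_ (hker (x * y) (by positivity)).1
      gcongr
      exact stieltjesWeight_mul_le ht hx0 hy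
    -- Finiteness of `I`, needed for the division, comes from the minorant at `y = 1`, where the
    -- transform of `g` is an absolutely convergent integral.
    have hIt : I ≠ ⊤ := by
      intro h
      have h1 := hlow 1 one_pos
      have h2 : ENNReal.ofReal (c * φ 1) ≠ 0 := by
        rw [Ne, ENNReal.ofReal_eq_zero, not_le]
        exact mul_pos hc (hφ 1 one_pos)
      rw [h, ENNReal.mul_top h2, top_le_iff] at h1
      exact ((hint 1 one_pos).integrableOn (s := Set.Ioi 0)).lintegral_lt_top.ne h1
    have hnorm : weightedNorm p v (fun x => (g x : 𝕜)) ≤ I ^ (1 / p) := by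
      refine ENNReal.rpow_le_rpow (setLIntegral_mono' measurableSet_Ioi fun x hx => ?_)
        (by positivity)
      refine ENNReal.ofReal_le_ofReal ?_
      rw [RCLike.norm_ofReal, abs_of_nonneg (hg0 x)]
      exact rpow_mul_dualTestFunction_rpow_le hp hψ hv n hx
    have hnorm2 : ENNReal.ofReal c * Φ * I ≤
        weightedNorm q u (struveTransform α fun x => (g x : 𝕜)) := by
      rw [weightedNorm_eq q hu hq0, one_div, ENNReal.le_rpow_inv_iff hq0,
        ENNReal.mul_rpow_of_nonneg _ _ hq0.le, ENNReal.mul_rpow_of_nonneg _ _ hq0.le, hΦ, one_div,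
        ENNReal.rpow_inv_rpow hq0.ne', mul_right_comm, ← ENNReal.mul_rpow_of_nonneg _ _ hq0.le,
        ← lintegral_const_mul' _ _ (ENNReal.rpow_ne_top_of_nonneg hq0.le
          (ENNReal.mul_ne_top ENNReal.ofReal_ne_top hIt))]
      refine setLIntegral_mono' measurableSet_Ioi fun y hy => ?_
      have hy0 : 0 < y := hy
      rw [← ENNReal.mul_rpow_of_nonneg _ _ hq0.le]
      refine ENNReal.rpow_le_rpow ?_ hq0.le
      have huy := hu.pos y hy
      have hkg : 0 ≤ᵐ[volume.restrict (Set.Ioi 0)] fun x => struveKernel α x y * g x := by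
        filter_upwards [ae_restrict_mem measurableSet_Ioi] with x hx
        exact mul_nonneg (hker0 _ (mul_pos hx hy0)) (hg0 x)
      rw [hft y hy, RCLike.norm_ofReal, abs_of_nonneg (integral_nonneg_of_ae hkg),
        ENNReal.ofReal_mul huy.le,
        ofReal_integral_eq_lintegral_ofReal (hint y hy).integrableOn hkg]
      calc ENNReal.ofReal c * I * ENNReal.ofReal (φ y * u y)
          = ENNReal.ofReal (u y) * (ENNReal.ofReal (c * φ y) * I) := by
            rw [ENNReal.ofReal_mul (hφ y hy).le, ENNReal.ofReal_mul hc.le]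
            ring
        _ ≤ _ := by
            gcongr
            exact hlow y hy
    have hall : ENNReal.ofReal c * Φ * I ≤ ENNReal.ofReal D * I ^ (1 / p) :=
      hnorm2.trans ((hD _ hf).trans (by gcongr))
    rcases eq_or_ne I 0 with h0 | h0
    · rw [h0, ENNReal.zero_rpow_of_pos (by positivity), mul_zero]
      exact zero_le
    have hIp0 : I ^ (1 / p) ≠ 0 := by simp [ENNReal.rpow_eq_zero_iff, h0, hIt]
    have hIpt : I ^ (1 / p) ≠ ⊤ := ENNReal.rpow_ne_top_of_nonneg (by positivity) hIt
    have hIsplit : I = I ^ (1 / p') * I ^ (1 / p) := by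
      rw [← ENNReal.rpow_add _ _ h0 hIt, one_div, one_div, add_comm, hp.inv_add_inv_eq_one,
        ENNReal.rpow_one]
    have hall' : ENNReal.ofReal c * Φ * I ^ (1 / p') ≤ ENNReal.ofReal D := by
      rw [hIsplit, ← mul_assoc] at hall
      rw [← hIsplit] at hall
      exact (ENNReal.mul_le_mul_iff_left hIp0 hIpt).1 hall
    rw [ENNReal.ofReal_div_of_pos hc, ENNReal.le_div_iff_mul_le
      (Or.inl (by simpa using hc)) (Or.inl ENNReal.ofReal_ne_top)]
    calc Φ * I ^ (1 / p') * ENNReal.ofReal c = ENNReal.ofReal c * Φ * I ^ (1 / p') := by ring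
      _ ≤ _ := hall'
  rcases eq_or_ne Φ 0 with h0 | h0
  · rw [h0, zero_mul]
    exact zero_le
  have hlim := tendsto_lintegral_mul_dualTestFunction (p' := p') hψ hψm hv
  have hDt : ENNReal.ofReal (D / c) ≠ ⊤ := ENNReal.ofReal_ne_top
  rw [mul_comm, ← ENNReal.le_div_iff_mul_le (Or.inl h0) (Or.inr hDt), one_div,
    ENNReal.rpow_inv_le_iff hp'0]
  refine le_of_tendsto' hlim fun n => ?_
  rw [← ENNReal.rpow_inv_le_iff hp'0, ← one_div,
    ENNReal.le_div_iff_mul_le (Or.inl h0) (Or.inr hDt), mul_comm]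
  exact main n

/-! ### The characterisation -/

theorem theorem5p2 (𝕜 : Type*) [RCLike 𝕜] (p q α : ℝ) (hp : 1 < p) (hpq : p ≤ q)
    (hα : 1 / 2 < α) (u v : ℝ → ℝ) (hu : IsWeight u) (hv : IsWeight v) :
    (∃ C : ℝ, 0 < C ∧ ∀ f : ℝ → 𝕜, HasStruveTransform α f →
        weightedNorm q u (struveTransform α f) ≤ ENNReal.ofReal C * weightedNorm p v f) ↔
      (⨆ (t : ℝ) (_ : 0 < t),
        (∫⁻ x in Set.Ioi (0 : ℝ),
            ENNReal.ofReal ((x ^ (α + 3 / 2) / (t ^ (-2 : ℤ) + x ^ 2)) ^ q * u x ^ q)) ^ (1 / q) *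
          (∫⁻ x in Set.Ioi (0 : ℝ),
            ENNReal.ofReal ((x ^ (α + 3 / 2) / (t ^ 2 + x ^ 2)) ^ Real.conjExponent p *
              v x ^ (-Real.conjExponent p))) ^ (1 / Real.conjExponent p)) < ⊤ := by
  have hpp : p.HolderConjugate (Real.conjExponent p) := Real.HolderConjugate.conjExponent hp
  set p' := Real.conjExponent p
  have hp0 := hpp.pos
  have hp'0 := hpp.symm.pos
  have hq0 : 0 < q := hp0.trans_le hpq
  obtain ⟨c, K, hc, hK, hker⟩ := exists_struve_bounds hα
  have eU : ∀ t : ℝ, 0 < t → ∫⁻ x in Set.Ioi (0 : ℝ),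
      ENNReal.ofReal ((x ^ (α + 3 / 2) / (t ^ (-2 : ℤ) + x ^ 2)) ^ q * u x ^ q) =
      ∫⁻ y in Set.Ioi (0 : ℝ),
        ENNReal.ofReal (stieltjesWeight (α + 3 / 2) (t ^ (-2 : ℤ)) y * u y) ^ q := by
    intro t ht
    refine setLIntegral_congr_fun measurableSet_Ioi fun x hx => ?_
    have h1 := (stieltjesWeight_pos (a := α + 3 / 2) (zpow_pos ht (-2)) hx).le
    have h2 := (hu.pos x hx).le
    rw [ENNReal.ofReal_rpow_of_nonneg (by positivity) hq0.le, Real.mul_rpow h1 h2]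
    rfl
  constructor
  · rintro ⟨D, -, hD⟩
    refine lt_of_le_of_lt (iSup₂_le fun t ht => ?_) (ENNReal.ofReal_lt_top (r := D / c))
    rw [eU t ht]
    exact lintegral_stieltjesWeight_mul_le hpp hpq hα hu hv hc hK hker hD ht
  · intro hsup
    set B := ⨆ (t : ℝ) (_ : 0 < t),
        (∫⁻ x in Set.Ioi (0 : ℝ),
            ENNReal.ofReal ((x ^ (α + 3 / 2) / (t ^ (-2 : ℤ) + x ^ 2)) ^ q * u x ^ q)) ^ (1 / q) *
          (∫⁻ x in Set.Ioi (0 : ℝ),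
            ENNReal.ofReal ((x ^ (α + 3 / 2) / (t ^ 2 + x ^ 2)) ^ p' *
              v x ^ (-p'))) ^ (1 / p') with hB
    have eV : ∀ t : ℝ, 0 < t → ∫⁻ x in Set.Ioi (0 : ℝ),
        ENNReal.ofReal ((x ^ (α + 3 / 2) / (t ^ 2 + x ^ 2)) ^ p' * v x ^ (-p')) =
        ∫⁻ x in Set.Ioi (0 : ℝ),
          ENNReal.ofReal (stieltjesWeight (α + 3 / 2) (t ^ 2) x * (v x)⁻¹) ^ p' := by
      intro t ht
      refine setLIntegral_congr_fun measurableSet_Ioi fun x hx => ?_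
      have h1 := (stieltjesWeight_pos (a := α + 3 / 2) (pow_pos ht 2) hx).le
      have h2 := (hv.pos x hx).le
      rw [ENNReal.ofReal_rpow_of_nonneg (by positivity) hp'0.le,
        Real.mul_rpow h1 (by positivity), Real.inv_rpow h2, ← Real.rpow_neg h2]
      rfl
    have hUV : ∀ t : ℝ, 0 < t →
        (∫⁻ y in Set.Ioi (0 : ℝ),
          ENNReal.ofReal (stieltjesWeight (α + 3 / 2) (t ^ (-2 : ℤ)) y * u y) ^ q) ^ (1 / q) *
        (∫⁻ x in Set.Ioi (0 : ℝ),
          ENNReal.ofReal (stieltjesWeight (α + 3 / 2) (t ^ 2) x * (v x)⁻¹) ^ p') ^ (1 / p') ≤ B := by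
      intro t ht
      rw [← eU t ht, ← eV t ht]
      exact le_iSup₂_of_le t ht le_rfl
    set A : ℝ≥0∞ := ENNReal.ofReal K * (32 * B * 2 ^ (1 / p)) with hA
    have hAt : A ≠ ⊤ := ENNReal.mul_ne_top ENNReal.ofReal_ne_top
      (ENNReal.mul_ne_top (ENNReal.mul_ne_top (by simp) hsup.ne)
        (ENNReal.rpow_ne_top_of_nonneg (by positivity) (by simp)))
    -- Adding `1` makes the constant positive by construction; positivity also settles the case
    -- where the norm of `f` is `⊤`.
    refine ⟨A.toReal + 1, by positivity, fun f hf => ?_⟩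
    have hA1 : A ≤ ENNReal.ofReal (A.toReal + 1) := by
      rw [← ENNReal.ofReal_toReal hAt]
      exact ENNReal.ofReal_le_ofReal (by simp)
    by_cases hfin : weightedNorm p v f = ⊤
    · rw [hfin, ENNReal.mul_top]
      · exact le_top
      · rw [Ne, ENNReal.ofReal_eq_zero, not_le]
        positivity
    · refine (weightedNorm_struveTransform_le hpp hpq hu hv hK (fun s hs => (hker s hs).2)
        (fun s hs => le_trans (by positivity) (hker s hs).1) hsup.ne hUV hf hfin).trans ?_
      gcongr
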